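/- **Setting.** Fix a finite alphabet $\mathcal S\subset\mathbb C\setminus\{0\}$ and let the symbols $s_1,\dots,s_N$ be independent and uniform on $\mathcal S$, where a generic symbol $s$ satisfies $\mathbb E|s|^2=1$, $\mathbb E s=0$, $\mathbb E s^2=0$, where $\mathcal S$ is centrally symmetric ($s\in\mathcal S\Rightarrow -s\in\mathcal S$), and where the kurtosis $\kappa=\mathbb E|s-\mathbb Es|^4/(\mathbb E|s-\mathbb Es|^2)^2$ satisfies $\kappa<2$ (sub-Gaussian constellation). Let $\mathbf F_N$ be the normalized $N$-point DFT matrix, $[\mathbf F_N]_{m,n}=N^{-1/2}e^{-j2\pi(m-1)(n-1)/N}$, and for $\tau\in\mathbb R$ let $\mathbf P_\tau=\mathbf F_N^H\operatorname{Diag}(e^{-j2\pi(n-1)\tau/N})_{n=1}^N\mathbf F_N$. Fix $\sigma>0$, $L\ge 1$, distinct delays $\tau_1,\dots,\tau_L\in\mathbb R$ and amplitudes $\beta_1,\dots,\beta_L\in\mathbb C\setminus\{0\}$, and put $\boldsymbol\theta=(\tau_\ell,\operatorname{Re}\beta_\ell,\operatorname{Im}\beta_\ell)_{\ell=1}^L\in\mathbb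 R^{3L}$ (all delays first, then all real parts, then all imaginary parts). For a matrix $\mathbf U\in\mathbb C^{N\times N}$ (waveform) let $\boldsymbol\mu=\sum_\ell\beta_\ell\mathbf P_{\tau_\ell}\mathbf U\mathbf s$, let $\mathbf J=\mathbf J(\mathbf U,\mathbf s)\in\mathbb R^{3L\times 3L}$ be the Fisher information matrix $J_{k,\ell}=\frac{2}{\sigma^2}\operatorname{Re}\{(\partial\boldsymbol\mu/\partial\theta_k)^H(\partial\boldsymbol\mu/\partial\theta_\ell)\}$ of $\boldsymbol\theta$ in the observation $\mathbf y\sim\mathcal{CN}(\boldsymbol\mu,\sigma^2\mathbf I)$, let $\bar{\mathbf J}=\mathbb E[\mathbf J]$ and $\mathbf Z=\bar{\mathbf J}^{-1}(\mathbf J-\bar{\mathbf J})$. Fix $\rho\in(0,1)$ and let $\Omega_N=\Omega_N(\mathbf U)$ be the event $\|\mathbf Z\|_2<\rho$. The amplitude CRB given $\mathbf s$ is $f_\beta(\mathbf U,\mathbf s)=\operatorname{Tr}(\mathbf T_\beta^T\mathbf T_\beta\mathbf J^{-1})$ with $\mathbf T_\beta=[\mathbf 0_{2L\times L},\mathbf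 I_{2L}]$. For a unit vector $\mathbf u\in\mathbb C^N$ put $p_k=|(\mathbf F_N\mathbf u)_k|^2$, $f_k=(k-1)/N$, $\bar f=\sum_kf_kp_k$ and $B_{\rm rms}(\mathbf u)=\big(\sum_k(f_k-\bar f)^2p_k\big)^{1/2}$. A unitary $\mathbf U\in\mathbb C^{N\times N}$ with columns $\mathbf u_1,\dots,\mathbf u_N$ is $\alpha$-frequency-spread if $\min_nB_{\rm rms}(\mathbf u_n)\ge\alpha$. **Corollary (amplitude estimation).** Let $\alpha>0$ be independent of $N$, and let $(\mathbf U_N)_N$ be a family of waveforms such that, for all large $N$, $\mathbf U_N\in\mathbb C^{N\times N}$ is unitary and $\alpha$-frequency-spread. Then there exist $c>0$ and $N_0\ge1$, independent of $N$, such that for all $N\ge N_0$: the event $\Omega_N(\mathbf U_N)\cap\Omega_N(\mathbf F_N^H)$ has positive probability, $\mathbf J(\mathbf U_N,\mathbf s)$ is invertible on $\Omega_N(\mathbf U_N)$, $\mathbf J(\mathbf F_N^H,\mathbf s)$ is invertible for every symbol vector, and $$\mathbb E\big[f_\beta(\mathbf U_N,\mathbf s)\,\big|\,\Omega_N(\mathbf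 U_N)\big]-\mathbb E\big[f_\beta(\mathbf F_N^H,\mathbf s)\,\big|\,\Omega_N(\mathbf F_N^H)\big]\ \ge\ \frac{c}{N^2}.$$ The same inequality holds if both expectations are conditioned on $\Omega_N(\mathbf U_N)$, and if both are conditioned on $\Omega_N(\mathbf U_N)\cap\Omega_N(\mathbf F_N^H)$. In particular, restricted to $\Omega_N$, OFDM ($\mathbf U=\mathbf F_N^H$) has a strictly lower amplitude CRB than the waveform $\mathbf U_N$ for all $N\ge N_0$. -/

import Mathlib

open scoped BigOperators

namespace OFDMCRB

open Matrix

noncomputable section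

/-- The normalized `N`-point DFT matrix `F_N` (indices start at `0`). -/
def dftMatrix (N : ℕ) : Matrix (Fin N) (Fin N) ℂ :=
  Matrix.of fun m n =>
    (1 / (Real.sqrt N : ℂ)) * Complex.exp (-(2 * Real.pi * Complex.I * (m : ℕ) * (n : ℕ)) / N)

/-- The OFDM waveform `F_N^H`. -/
def ofdm (N : ℕ) : Matrix (Fin N) (Fin N) ℂ := (dftMatrix N)ᴴ

/-- The discrete power spectrum `p_k = |(F_N u)_k|²`. -/
def powerSpectrum {N : ℕ} (u : Fin N → ℂ) (k : Fin N) : ℝ := ‖(dftMatrix N *ᵥ u) k‖ ^ 2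

/-- The normalized frequency grid `0, 1/N, …, (N-1)/N`. -/
def freq {N : ℕ} (k : Fin N) : ℝ := ((k : ℕ) : ℝ) / N

/-- The discrete spectral centroid. -/
def centroid {N : ℕ} (u : Fin N → ℂ) : ℝ := ∑ k, freq k * powerSpectrum u k

/-- The discrete RMS bandwidth: the standard deviation of the power spectrum. -/
def rmsBandwidth {N : ℕ} (u : Fin N → ℂ) : ℝ :=
  Real.sqrt (∑ k, (freq k - centroid u) ^ 2 * powerSpectrum u k)

/-- `U` is unitary and each of its columns has RMS bandwidth at least `α`. -/
def IsFrequencySpread {N : ℕ} (α : ℝ) (U : Matrix (Fin N) (Fin N) ℂ) : Prop :=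
  U ∈ Matrix.unitaryGroup (Fin N) ℂ ∧ ∀ n, α ≤ rmsBandwidth fun k => U k n

/-- The periodic (possibly fractional) delay operator `P_τ`. -/
def delayMatrix (N : ℕ) (τ : ℝ) : Matrix (Fin N) (Fin N) ℂ :=
  (dftMatrix N)ᴴ
    * Matrix.diagonal (fun n : Fin N =>
        Complex.exp (-(2 * Real.pi * Complex.I * (n : ℕ) * (τ : ℂ)) / N))
    * dftMatrix N

/-- Index set of the `3L` real parameters: the delays, then the real parts and the imaginary
parts of the amplitudes. -/
abbrev Param (L : ℕ) : Type := Fin L ⊕ (Fin L ⊕ Fin L)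

/-- The parameter vector `θ = (τ, Re β, Im β)`. -/
def paramVec {L : ℕ} (τ : Fin L → ℝ) (β : Fin L → ℂ) : Param L → ℝ :=
  Sum.elim τ (Sum.elim (fun l => (β l).re) (fun l => (β l).im))

/-- The noiseless echo `μ_θ = ∑ β_l P_{τ_l} x` of the transmitted block `x`. -/
def meanSignal {L N : ℕ} (x : Fin N → ℂ) (θ : Param L → ℝ) : Fin N → ℂ :=
  ∑ l : Fin L,
    ((θ (.inr (.inl l)) : ℂ) + (θ (.inr (.inr l)) : ℂ) * Complex.I) •
      (delayMatrix N (θ (.inl l)) *ᵥ x)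

/-- The partial derivative `∂μ/∂θ_k`. -/
def partialMean {L N : ℕ} (x : Fin N → ℂ) (θ : Param L → ℝ) (k : Param L) : Fin N → ℂ :=
  deriv (fun t : ℝ => meanSignal x (Function.update θ k t)) (θ k)

/-- The Fisher information matrix of `θ` in the observation `y ∼ CN(μ_θ, σ² I)` for the
transmitted block `x = U s`. -/
def fim {L N : ℕ} (σ : ℝ) (τ : Fin L → ℝ) (β : Fin L → ℂ) (U : Matrix (Fin N) (Fin N) ℂ)
    (s : Fin N → ℂ) : Matrix (Param L) (Param L) ℝ :=
  Matrix.of fun k l =>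
    2 / σ ^ 2 *
      (star (partialMean (U *ᵥ s) (paramVec τ β) k) ⬝ᵥ
        partialMean (U *ᵥ s) (paramVec τ β) l).re

/-- The matrix `T_β = [0, I]` selecting the amplitude parameters `(Re β, Im β)` from `θ`. -/
def ampSelection (L : ℕ) : Matrix (Fin L ⊕ Fin L) (Param L) ℝ := Matrix.fromCols 0 1

/-- The amplitude CRB `Tr(T J⁻¹)`, `T = T_βᵀ T_β`, for a given symbol vector `s`. -/
def ampCRB {L N : ℕ} (σ : ℝ) (τ : Fin L → ℝ) (β : Fin L → ℂ) (U : Matrix (Fin N) (Fin N) ℂ)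
    (s : Fin N → ℂ) : ℝ :=
  (((ampSelection L)ᵀ * ampSelection L) * (fim σ τ β U s)⁻¹).trace

/-- The kurtosis of the uniform distribution on `S`. -/
def kurtosis (S : Finset ℂ) : ℝ :=
  (𝔼 s ∈ S, ‖s - 𝔼 t ∈ S, t‖ ^ 4) / (𝔼 s ∈ S, ‖s - 𝔼 t ∈ S, t‖ ^ 2) ^ 2

/-- All length-`N` symbol vectors with entries in `S`. Independent uniform symbols amount to
the uniform distribution on this finite set, so expectations are averages over it, and
conditional expectations given an event `A` are averages over `A`. -/
def symbolVectors (S : Finset ℂ) (N : ℕ) : Finset (Fin N → ℂ) :=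
  Fintype.piFinset fun _ => S

/-- The expected Fisher information matrix `E[J]`. -/
def meanFim {L N : ℕ} (S : Finset ℂ) (σ : ℝ) (τ : Fin L → ℝ) (β : Fin L → ℂ)
    (U : Matrix (Fin N) (Fin N) ℂ) : Matrix (Param L) (Param L) ℝ :=
  𝔼 s ∈ symbolVectors S N, fim σ τ β U s

/-- The relative fluctuation `Z = E[J]⁻¹ (J - E[J])`. -/
def fluctuation {L N : ℕ} (S : Finset ℂ) (σ : ℝ) (τ : Fin L → ℝ) (β : Fin L → ℂ)
    (U : Matrix (Fin N) (Fin N) ℂ) (s : Fin N → ℂ) : Matrix (Param L) (Param L) ℝ :=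
  (meanFim S σ τ β U)⁻¹ * (fim σ τ β U s - meanFim S σ τ β U)

/-- The event `Ω_N` of the waveform `U`: the symbol vectors with `‖Z‖₂ < ρ` (spectral norm). -/
def goodEvent {L N : ℕ} (S : Finset ℂ) (σ : ℝ) (τ : Fin L → ℝ) (β : Fin L → ℂ) (ρ : ℝ)
    (U : Matrix (Fin N) (Fin N) ℂ) : Finset (Fin N → ℂ) :=
  {s ∈ symbolVectors S N | ‖Matrix.toEuclideanCLM (𝕜 := ℝ) (fluctuation S σ τ β U s)‖ < ρ}

/-- The amplitude CRB of the waveform `U` conditioned on the event `A`. -/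
def condAmpCRB {L N : ℕ} (σ : ℝ) (τ : Fin L → ℝ) (β : Fin L → ℂ)
    (U : Matrix (Fin N) (Fin N) ℂ) (A : Finset (Fin N → ℂ)) : ℝ :=
  𝔼 s ∈ A, ampCRB σ τ β U s

end

end OFDMCRB

/-!
Write `V = F U` for the symbol-to-frequency map of a unitary waveform `U`, and `X = V s`. The Fisher
information is linear in the received bin powers, `J = ∑ₙ |Xₙ|² M(n/N)`, with a fixed
matrix-valued function `M` (`infoDensity`) on `[0, 1]` that does not depend on the waveform
(`fim_eq_sum`). Its mean `J̄ = ∑ₙ M(n/N)` is therefore the same for all unitary waveforms, and it is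
of exact order `N`, because the responses `(c + d f) e^{-2πi f τ}` to the parameters are linearly
independent (`exists_avgInfo_coercive`). With `H = J̄⁻¹` and `Δ = J - J̄`,

`J⁻¹ = H - H Δ H + H Δ H Δ H - H Δ H Δ H Δ J⁻¹`.

The entries of `Δ` are centred quadratic forms in the symbols, so that `E‖Δ‖⁴ = O(N²)`
(`exists_expect_norm_deviation_pow_four_le`). Hence `Ω_N` fails with probability `O(N⁻²)`, and on any
event of probability `1 - O(N⁻²)` on which `J⁻¹ = O(N⁻¹)` the conditional amplitude bound equals
`Tr(T H) + E Tr(T H Δ H Δ H) + O(N^{-5/2})` (`exists_condAmpCRB_expansion`). For OFDM, `J⁻¹ = O(N⁻¹)`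
holds for every symbol vector, since `|Xₙ|² = |sₙ|²` is bounded below; this covers all the events in
the theorem.

It remains to compare the second-order terms, for which a gap of order `N⁻²` is needed. The
covariance of the bin powers is `I - (2 - κ) W Wᵀ` with the doubly stochastic `W_{ni} = |V_{ni}|²`
(`expect_binPower_covariance`), and for OFDM `W = I`. So the second-order terms differ by `2 - κ`
times an average, over the column spectra of `W`, of the variances of `n ↦ H^{1/2} M(n/N) H T_βᵀ`.
These variances are bounded below as follows (`exists_secondOrder_gap`). Let `v` be the amplitude
direction `i β` of one target. Delaying the target and rotating its phase act proportionally, so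
that the delay row of `M(f)` is `-2π f` times its row along `v` (`delay_row_eq`). Thus both
`φₙ = v · M(n/N) H v` and `(n/N) φₙ` are linear in `M(n/N) H T_βᵀ`, and the variance dominates,
up to a constant, the average of `(f - f')² φ²`, hence `α²` times the average of `φ²` for a spread
spectrum. Since
`∑ₙ φₙ = v · J̄ H v = |β|²` is fixed, Cauchy–Schwarz bounds `∑ₙ φₙ²` below by `|β|⁴ / N`.
-/

namespace OFDMCRB

open Matrix

noncomputable section

/-! ### Averages over independent symbols -/

lemma symbols_nonempty {S : Finset ℂ} (hpower : 𝔼 s ∈ S, ‖s‖ ^ 2 = 1) : S.Nonempty := by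
  rcases S.eq_empty_or_nonempty with rfl | h
  · simp at hpower
  · exact h

section LinearForms

variable {ι : Type*} [Fintype ι] [DecidableEq ι]

/-- Resampling one coordinate does not change an average over the product space. -/
lemma expect_piFinset_update {M : Type*} [AddCommMonoid M] [Module ℚ≥0 M] (S : Finset ℂ)
    (φ : (ι → ℂ) → M) (a : ι) :
    𝔼 s ∈ Fintype.piFinset (fun _ : ι => S), φ s =
      𝔼 s ∈ Fintype.piFinset (fun _ : ι => S), 𝔼 t ∈ S, φ (Function.update s a t) := by
  rcases S.eq_empty_or_nonempty with rfl | hS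
  · have : Fintype.piFinset (fun _ : ι => (∅ : Finset ℂ)) = ∅ :=
      Fintype.piFinset_eq_empty.2 ⟨a, rfl⟩
    simp [this]
  · rw [← Finset.expect_product']
    calc 𝔼 s ∈ Fintype.piFinset (fun _ : ι => S), φ s
        = 𝔼 s ∈ Fintype.piFinset (fun _ : ι => S), 𝔼 _t ∈ S, φ s := by
          simp [Finset.expect_const hS]
      _ = 𝔼 p ∈ Fintype.piFinset (fun _ : ι => S) ×ˢ S, φ p.1 := by
          rw [← Finset.expect_product']
      _ = _ := by
          -- swapping the coordinate `a` of the vector with the extra symbol is an involution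
          refine Finset.expect_nbij' (fun p => (Function.update p.1 a p.2, p.1 a))
            (fun p => (Function.update p.1 a p.2, p.1 a)) ?_ ?_ ?_ ?_ ?_
          · rintro ⟨s, t⟩ h
            simp only [Finset.mem_product, Fintype.mem_piFinset] at h ⊢
            refine ⟨fun i => ?_, h.1 a⟩
            by_cases hi : i = a
            · subst hi; simpa using h.2
            · simpa [hi] using h.1 i
          · rintro ⟨s, t⟩ h
            simp only [Finset.mem_product, Fintype.mem_piFinset] at h ⊢
            refine ⟨fun i => ?_, h.1 a⟩
            by_cases hi : i = a
            · subst hi; simpa using h.2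
            · simpa [hi] using h.1 i
          · rintro ⟨s, t⟩ -; simp
          · rintro ⟨s, t⟩ -; simp
          · rintro ⟨s, t⟩ -; simp

/-- A factor depending on one symbol only splits off the average. -/
lemma expect_piFinset_mul {𝕜 : Type*} [Field 𝕜] [CharZero 𝕜] (S : Finset ℂ) (a : ι) (h : ℂ → 𝕜)
    (g : (ι → ℂ) → 𝕜) (hg : ∀ s t, g (Function.update s a t) = g s) :
    𝔼 s ∈ Fintype.piFinset (fun _ : ι => S), h (s a) * g s =
      (𝔼 t ∈ S, h t) * 𝔼 s ∈ Fintype.piFinset (fun _ : ι => S), g s := by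
  rw [expect_piFinset_update S _ a]
  simp only [hg, Function.update_self]
  simp only [← Finset.expect_mul]
  rw [← Finset.mul_expect]

/-- Cauchy–Schwarz for averages. -/
lemma expect_mul_sq_le {Ω : Type*} (P : Finset Ω) (f g : Ω → ℝ) :
    (𝔼 s ∈ P, f s * g s) ^ 2 ≤ (𝔼 s ∈ P, f s ^ 2) * 𝔼 s ∈ P, g s ^ 2 := by
  simp only [Finset.expect_eq_sum_div_card, div_pow, div_mul_div_comm, ← sq]
  gcongr
  exact Finset.sum_mul_sq_le_sq_mul_sq P f g

/-- Growth of a fourth moment along a martingale-type increment `D`: the increments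
`d` of the square roots of the fourth moments add up. -/
lemma expect_pow_four_add_le {Ω : Type*} (P : Finset Ω) (f D : Ω → ℝ) {F d : ℝ}
    (hF : 0 ≤ F) (hd : 0 ≤ d) (hcross : 𝔼 s ∈ P, f s ^ 3 * D s = 0)
    (hf : 𝔼 s ∈ P, f s ^ 4 ≤ F ^ 2) (hD : 𝔼 s ∈ P, D s ^ 4 ≤ d ^ 2) :
    𝔼 s ∈ P, (f s + D s) ^ 4 ≤ (F + 4 * d) ^ 2 := by
  have hCS : 𝔼 s ∈ P, f s ^ 2 * D s ^ 2 ≤ F * d := by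
    refine abs_le_of_sq_le_sq' ?_ (by positivity) |>.2
    calc (𝔼 s ∈ P, f s ^ 2 * D s ^ 2) ^ 2
        ≤ (𝔼 s ∈ P, (f s ^ 2) ^ 2) * 𝔼 s ∈ P, (D s ^ 2) ^ 2 := expect_mul_sq_le P _ _
      _ = (𝔼 s ∈ P, f s ^ 4) * 𝔼 s ∈ P, D s ^ 4 := by simp only [← pow_mul]
      _ ≤ F ^ 2 * d ^ 2 := by
          gcongr
      _ = (F * d) ^ 2 := by ring
  calc 𝔼 s ∈ P, (f s + D s) ^ 4
      ≤ 𝔼 s ∈ P, (f s ^ 4 + 4 * (f s ^ 3 * D s) + 8 * (f s ^ 2 * D s ^ 2) + 3 * D s ^ 4) := by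
        refine Finset.expect_le_expect fun s _ => ?_
        -- the term `4 f D³` is absorbed by `2 f² D² + 2 D⁴`
        nlinarith [sq_nonneg (f s * D s - D s ^ 2)]
    _ = (𝔼 s ∈ P, f s ^ 4) + 4 * (𝔼 s ∈ P, f s ^ 3 * D s) + 8 * (𝔼 s ∈ P, f s ^ 2 * D s ^ 2)
          + 3 * 𝔼 s ∈ P, D s ^ 4 := by
        simp only [Finset.expect_add_distrib, Finset.mul_expect]
    _ ≤ F ^ 2 + 4 * 0 + 8 * (F * d) + 3 * d ^ 2 := by
        rw [hcross]; gcongr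
    _ ≤ (F + 4 * d) ^ 2 := by nlinarith [sq_nonneg d]

variable {S : Finset ℂ} {B : ℝ}

/-- Fourth moment of a real linear form in the symbols. -/
lemma expect_linear_re_pow_four (hmean : 𝔼 s ∈ S, s = 0) (hB : ∀ s ∈ S, ‖s‖ ≤ B) (hB1 : 1 ≤ B)
    (c : ι → ℂ) (T : Finset ι) :
    𝔼 s ∈ Fintype.piFinset (fun _ : ι => S), (∑ j ∈ T, (c j * s j).re) ^ 4 ≤
      (4 * B ^ 2 * ∑ j ∈ T, ‖c j‖ ^ 2) ^ 2 := by
  induction T using Finset.induction_on with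
  | empty => simp
  | insert a T ha ih =>
    have key := expect_pow_four_add_le (Fintype.piFinset (fun _ : ι => S))
      (fun s => ∑ j ∈ T, (c j * s j).re) (fun s => (c a * s a).re)
      (F := 4 * B ^ 2 * ∑ j ∈ T, ‖c j‖ ^ 2) (d := B ^ 2 * ‖c a‖ ^ 2) (by positivity)
      (by positivity) ?_ ih ?_
    · simp only [Finset.sum_insert ha]
      convert key using 3 <;> ring
    · have := expect_piFinset_mul S a (fun z => (c a * z).re)
        (fun s : ι → ℂ => (∑ j ∈ T, (c j * s j).re) ^ 3) (fun s t => by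
          congr 1
          refine Finset.sum_congr rfl fun j hj => ?_
          rw [Function.update_of_ne (by rintro rfl; exact ha hj)])
      simp only [mul_comm (_ ^ 3)]
      rw [this]
      have h0 : 𝔼 t ∈ S, (c a * t).re = 0 := by
        have := map_expect (Complex.reLm.restrictScalars ℚ≥0) (fun t => c a * t) S
        simp only [LinearMap.coe_restrictScalars, Complex.reLm_coe] at this
        rw [← this, ← Finset.mul_expect, hmean]; simp
      rw [h0, zero_mul]
    · have hSB : ∀ s ∈ Fintype.piFinset (fun _ : ι => S),
          (c a * s a).re ^ 4 ≤ (B ^ 2 * ‖c a‖ ^ 2) ^ 2 := by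
        intro s hs
        have h1 : |(c a * s a).re| ≤ ‖c a‖ * B := by
          refine (Complex.abs_re_le_norm _).trans ?_
          rw [norm_mul]
          gcongr
          exact hB _ (Fintype.mem_piFinset.1 hs a)
        calc (c a * s a).re ^ 4 = |(c a * s a).re| ^ 4 := by
              rw [Even.pow_abs (by decide)]
          _ ≤ (‖c a‖ * B) ^ 4 := by gcongr
          _ = _ := by ring
      rcases (Fintype.piFinset (fun _ : ι => S)).eq_empty_or_nonempty with h | h
      · rw [h]; simp; positivity
      · exact Finset.expect_le h hSB

/-- Fourth moment of a complex linear form in the symbols. -/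
lemma expect_linear_norm_pow_four (hmean : 𝔼 s ∈ S, s = 0) (hB : ∀ s ∈ S, ‖s‖ ≤ B) (hB1 : 1 ≤ B)
    (c : ι → ℂ) (T : Finset ι) :
    𝔼 s ∈ Fintype.piFinset (fun _ : ι => S), ‖∑ j ∈ T, c j * s j‖ ^ 4 ≤
      (8 * B ^ 2 * ∑ j ∈ T, ‖c j‖ ^ 2) ^ 2 := by
  have h1 := expect_linear_re_pow_four hmean hB hB1 c T
  have h2 := expect_linear_re_pow_four hmean hB hB1 (fun j => -Complex.I * c j) T
  have h3 : ∀ z : ℂ, ‖z‖ ^ 4 ≤ 2 * z.re ^ 4 + 2 * (-Complex.I * z).re ^ 4 := by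
    intro z
    have : ‖z‖ ^ 4 = (z.re ^ 2 + z.im ^ 2) ^ 2 := by
      rw [show ‖z‖ ^ 4 = (‖z‖ ^ 2) ^ 2 by ring, Complex.sq_norm, Complex.normSq_apply]; ring
    rw [this]
    simp
    nlinarith [sq_nonneg (z.re ^ 2 - z.im ^ 2)]
  calc 𝔼 s ∈ Fintype.piFinset (fun _ : ι => S), ‖∑ j ∈ T, c j * s j‖ ^ 4
      ≤ 𝔼 s ∈ Fintype.piFinset (fun _ : ι => S), (2 * (∑ j ∈ T, (c j * s j).re) ^ 4
          + 2 * (∑ j ∈ T, (-Complex.I * c j * s j).re) ^ 4) := by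
        refine Finset.expect_le_expect fun s _ => (h3 _).trans (le_of_eq ?_)
        simp only [Finset.mul_sum, Complex.re_sum, mul_assoc]
    _ ≤ 2 * (4 * B ^ 2 * ∑ j ∈ T, ‖c j‖ ^ 2) ^ 2 + 2 * (4 * B ^ 2 * ∑ j ∈ T, ‖c j‖ ^ 2) ^ 2 := by
        rw [Finset.expect_add_distrib, ← Finset.mul_expect, ← Finset.mul_expect]
        simp only [norm_mul, norm_neg, Complex.norm_I, one_mul] at h2
        gcongr
    _ = _ := by ring

end LinearForms

/-! ### Quadratic forms and mixed moments of order four -/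

section QuadraticForms

variable {ι : Type*} [Fintype ι] [DecidableEq ι] {S : Finset ℂ} {B : ℝ}

/-- Fourth moment of a centred Hermitian quadratic form in the symbols, in terms of the
Frobenius norm of its matrix; the quadratic form restricted to `T` grows by an increment that is
conditionally centred whenever a coordinate is added to `T`. -/
lemma expect_quadratic_pow_four (hmean : 𝔼 s ∈ S, s = 0) (hpower : 𝔼 s ∈ S, ‖s‖ ^ 2 = 1)
    (hB : ∀ s ∈ S, ‖s‖ ≤ B) (hB1 : 1 ≤ B) (A : Matrix ι ι ℂ) (hA : A.IsHermitian)
    (T : Finset ι) :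
    𝔼 s ∈ Fintype.piFinset (fun _ : ι => S),
        ((∑ i ∈ T, ∑ j ∈ T, star (s i) * A i j * s j).re - ∑ i ∈ T, (A i i).re) ^ 4 ≤
      (400 * B ^ 4 * ∑ i ∈ T, ∑ j ∈ T, ‖A i j‖ ^ 2) ^ 2 := by
  induction T using Finset.induction_on with
  | empty => simp
  | insert a T ha ih =>
    have hherm : ∀ i j, star (A i j) = A j i := fun i j => hA.apply j i
    have hne : ∀ j ∈ T, j ≠ a := by rintro j hj rfl; exact ha hj
    set Lf : (ι → ℂ) → ℂ := fun s => ∑ j ∈ T, A a j * s j with hLf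
    set D : (ι → ℂ) → ℝ := fun s => (A a a).re * (‖s a‖ ^ 2 - 1) + 2 * (star (s a) * Lf s).re
      with hD
    set f : (ι → ℂ) → ℝ := fun s =>
      (∑ i ∈ T, ∑ j ∈ T, star (s i) * A i j * s j).re - ∑ i ∈ T, (A i i).re with hf
    set Q := ∑ j ∈ T, ‖A a j‖ ^ 2 with hQ
    have hfun : ∀ s : ι → ℂ, (∑ i ∈ insert a T, ∑ j ∈ insert a T, star (s i) * A i j * s j).re
        - ∑ i ∈ insert a T, (A i i).re = f s + D s := by
      intro s
      have haa : ((A a a).re : ℂ) = A a a := hA.coe_re_apply_self a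
      have h1 : (star (s a) * A a a * s a).re = (A a a).re * ‖s a‖ ^ 2 := by
        rw [← haa, Complex.sq_norm, Complex.normSq_apply]
        simp; ring
      have h2 : (∑ j ∈ T, star (s a) * A a j * s j).re = (star (s a) * Lf s).re := by
        rw [hLf, Finset.mul_sum]
        simp only [mul_assoc]
      have h3 : (∑ i ∈ T, star (s i) * A i a * s a).re = (star (s a) * Lf s).re := by
        rw [← h2, Complex.re_sum, Complex.re_sum]
        refine Finset.sum_congr rfl fun i _ => ?_
        rw [← hherm a i, ← Complex.conj_re, ← Complex.star_def]
        simp only [star_mul', star_star]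
        ring_nf
      simp only [Finset.sum_insert ha, Finset.sum_add_distrib, Complex.add_re]
      rw [h1, h2, h3]
      simp only [hf, hD]
      ring
    have key := expect_pow_four_add_le (Fintype.piFinset (fun _ : ι => S)) f D
      (F := 400 * B ^ 4 * ∑ i ∈ T, ∑ j ∈ T, ‖A i j‖ ^ 2)
      (d := 100 * B ^ 4 * (‖A a a‖ ^ 2 + Q)) (by positivity) (by positivity) ?_ ih ?_
    · simp only [hfun]
      refine key.trans ?_
      simp only [Finset.sum_insert ha, Finset.sum_add_distrib]
      have : 0 ≤ ∑ i ∈ T, ‖A i a‖ ^ 2 := by positivity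
      have hB0 : 0 ≤ B ^ 4 := by positivity
      refine pow_le_pow_left₀ (by positivity) ?_ 2
      rw [← hQ]
      nlinarith [mul_nonneg hB0 this]
    · have hupd : ∀ (s : ι → ℂ) t, f (Function.update s a t) = f s := by
        intro s t
        simp only [hf]
        congr 2
        refine Finset.sum_congr rfl fun i hi => Finset.sum_congr rfl fun j hj => ?_
        rw [Function.update_of_ne (hne i hi), Function.update_of_ne (hne j hj)]
      have hupdL : ∀ (s : ι → ℂ) t, Lf (Function.update s a t) = Lf s := by
        intro s t
        simp only [hLf]
        refine Finset.sum_congr rfl fun j hj => ?_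
        rw [Function.update_of_ne (hne j hj)]
      rw [expect_piFinset_update S _ a]
      refine Finset.expect_eq_zero fun s _ => ?_
      simp only [hupd, hD, hupdL, Function.update_self]
      rw [← Finset.mul_expect, Finset.expect_add_distrib, ← Finset.mul_expect, ← Finset.mul_expect]
      have hS : S.Nonempty := symbols_nonempty hpower
      have e1 : 𝔼 t ∈ S, (‖t‖ ^ 2 - 1 : ℝ) = 0 := by
        rw [Finset.expect_sub_distrib, hpower, Finset.expect_const hS, sub_self]
      have e2 : 𝔼 t ∈ S, (star t * Lf s).re = 0 := by
        have := map_expect (Complex.reLm.restrictScalars ℚ≥0) (fun t => t * star (Lf s)) S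
        simp only [LinearMap.coe_restrictScalars, Complex.reLm_coe, ← Finset.expect_mul, hmean,
          zero_mul, Complex.zero_re] at this
        rw [this]
        refine Finset.expect_congr rfl fun t _ => ?_
        rw [← Complex.conj_re, ← Complex.star_def]
        simp
      rw [e1, e2]; ring
    · have hlin := expect_linear_norm_pow_four hmean hB hB1 (fun j => A a j) T
      have hpt : ∀ s ∈ Fintype.piFinset (fun _ : ι => S),
          D s ^ 4 ≤ 128 * B ^ 8 * ‖A a a‖ ^ 4 + 128 * B ^ 4 * ‖Lf s‖ ^ 4 := by
        intro s hs
        have hsB : ‖s a‖ ≤ B := hB _ (Fintype.mem_piFinset.1 hs a)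
        set x := (A a a).re * (‖s a‖ ^ 2 - 1)
        set y := 2 * (star (s a) * Lf s).re
        have hx : |x| ≤ ‖A a a‖ * (2 * B ^ 2) := by
          rw [abs_mul]
          refine mul_le_mul (Complex.abs_re_le_norm _) ?_ (abs_nonneg _) (norm_nonneg _)
          have : ‖s a‖ ^ 2 ≤ B ^ 2 := by gcongr
          rw [abs_le]; constructor <;> nlinarith [sq_nonneg ‖s a‖]
        have hy : |y| ≤ 2 * (B * ‖Lf s‖) := by
          rw [abs_mul, abs_two]
          refine mul_le_mul_of_nonneg_left ((Complex.abs_re_le_norm _).trans ?_) zero_le_two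
          rw [norm_mul, norm_star]; gcongr
        have hx4 : x ^ 4 ≤ (‖A a a‖ * (2 * B ^ 2)) ^ 4 := by
          rw [← Even.pow_abs (by decide : Even 4) x]; gcongr
        have hy4 : y ^ 4 ≤ (2 * (B * ‖Lf s‖)) ^ 4 := by
          rw [← Even.pow_abs (by decide : Even 4) y]; gcongr
        have hxy : (x + y) ^ 4 ≤ 8 * x ^ 4 + 8 * y ^ 4 := by
          have h2 : (x + y) ^ 2 ≤ 2 * (x ^ 2 + y ^ 2) := by nlinarith [sq_nonneg (x - y)]
          have h4 : ((x + y) ^ 2) ^ 2 ≤ (2 * (x ^ 2 + y ^ 2)) ^ 2 := by gcongr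
          nlinarith [sq_nonneg (x ^ 2 - y ^ 2)]
        calc D s ^ 4 = (x + y) ^ 4 := rfl
          _ ≤ 8 * x ^ 4 + 8 * y ^ 4 := hxy
          _ ≤ 8 * (‖A a a‖ * (2 * B ^ 2)) ^ 4 + 8 * (2 * (B * ‖Lf s‖)) ^ 4 := by gcongr
          _ = _ := by ring
      have hP : (Fintype.piFinset (fun _ : ι => S)).Nonempty :=
        Fintype.piFinset_nonempty.2 fun _ => symbols_nonempty hpower
      calc 𝔼 s ∈ Fintype.piFinset (fun _ : ι => S), D s ^ 4
          ≤ 𝔼 s ∈ Fintype.piFinset (fun _ : ι => S),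
              (128 * B ^ 8 * ‖A a a‖ ^ 4 + 128 * B ^ 4 * ‖Lf s‖ ^ 4) :=
            Finset.expect_le_expect hpt
        _ = 128 * B ^ 8 * ‖A a a‖ ^ 4
              + 128 * B ^ 4 * 𝔼 s ∈ Fintype.piFinset (fun _ : ι => S), ‖Lf s‖ ^ 4 := by
            rw [Finset.expect_add_distrib, Finset.expect_const hP, ← Finset.mul_expect]
        _ ≤ 128 * B ^ 8 * ‖A a a‖ ^ 4 + 128 * B ^ 4 * (8 * B ^ 2 * Q) ^ 2 := by gcongr
        _ ≤ (100 * B ^ 4 * (‖A a a‖ ^ 2 + Q)) ^ 2 := by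
            have hQ0 : 0 ≤ Q := by positivity
            have : 0 ≤ B ^ 8 * (‖A a a‖ ^ 2 * Q) := by positivity
            have h5 : 0 ≤ B ^ 8 * ‖A a a‖ ^ 4 := by positivity
            have h6 : 0 ≤ B ^ 8 * Q ^ 2 := by positivity
            nlinarith

/-- The mixed moments of order four of circular symbols of kurtosis `κ`. -/
lemma expect_four_symbols (hmean : 𝔼 s ∈ S, s = 0) (hpower : 𝔼 s ∈ S, ‖s‖ ^ 2 = 1)
    (hpseudo : 𝔼 s ∈ S, s ^ 2 = 0) (κ : ℝ) (hκ : 𝔼 s ∈ S, ‖s‖ ^ 4 = κ) (i j k l : ι) :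
    𝔼 s ∈ Fintype.piFinset (fun _ : ι => S), s i * star (s j) * s k * star (s l) =
      (if i = j then if k = l then (1 : ℂ) else 0 else 0)
        + (if i = l then if k = j then 1 else 0 else 0)
        + (if i = j then if i = k then if i = l then (κ : ℂ) - 2 else 0 else 0 else 0) := by
  have hS : S.Nonempty := symbols_nonempty hpower
  have hP : (Fintype.piFinset (fun _ : ι => S)).Nonempty :=
    Fintype.piFinset_nonempty.2 fun _ => hS
  have hmean' : 𝔼 s ∈ S, star s = 0 := by
    have := map_expect (starRingEnd ℂ) (fun s => s) S
    simp only [hmean, map_zero] at this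
    rw [this]; rfl
  have hpow' : 𝔼 s ∈ S, s * star s = 1 := by
    have : (𝔼 s ∈ S, ((‖s‖ ^ 2 : ℝ) : ℂ)) = ((𝔼 s ∈ S, ‖s‖ ^ 2 : ℝ) : ℂ) := by
      have := map_expect (Complex.ofRealHom) (fun s : ℂ => ‖s‖ ^ 2) S
      exact this.symm
    rw [hpower] at this
    rw [← Complex.ofReal_one, ← this]
    refine Finset.expect_congr rfl fun s _ => ?_
    rw [Complex.star_def, Complex.mul_conj, Complex.normSq_eq_norm_sq]
  have hκ' : 𝔼 s ∈ S, s * star s * s * star s = κ := by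
    have : (𝔼 s ∈ S, ((‖s‖ ^ 4 : ℝ) : ℂ)) = ((𝔼 s ∈ S, ‖s‖ ^ 4 : ℝ) : ℂ) := by
      have := map_expect (Complex.ofRealHom) (fun s : ℂ => ‖s‖ ^ 4) S
      exact this.symm
    rw [← hκ, ← this]
    refine Finset.expect_congr rfl fun s _ => ?_
    rw [mul_assoc (s * star s), Complex.star_def, Complex.mul_conj, Complex.normSq_eq_norm_sq]
    push_cast; ring
  -- the average of one symbol, and of a symbol against a function of the other symbols
  have single : ∀ (a : ι) (h : ℂ → ℂ),
      𝔼 s ∈ Fintype.piFinset (fun _ : ι => S), h (s a) = 𝔼 t ∈ S, h t := by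
    intro a h
    have := expect_piFinset_mul S a h (fun _ : ι → ℂ => (1 : ℂ)) (fun _ _ => rfl)
    simpa [Finset.expect_const hP] using this
  by_cases hi : i ≠ j ∧ i ≠ k ∧ i ≠ l
  · obtain ⟨hij, hik, hil⟩ := hi
    have := expect_piFinset_mul S i (fun z => z)
      (fun s : ι → ℂ => star (s j) * s k * star (s l)) (fun s t => by
        simp [Function.update_of_ne hij.symm, Function.update_of_ne hik.symm,
          Function.update_of_ne hil.symm])
    simp only [hmean, zero_mul, ← mul_assoc] at this
    rw [this]; simp [hij, hil]
  by_cases hj : j ≠ i ∧ j ≠ k ∧ j ≠ l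
  · obtain ⟨hij, hik, hil⟩ := hj
    have := expect_piFinset_mul S j (fun z => star z)
      (fun s : ι → ℂ => s i * s k * star (s l)) (fun s t => by
        simp [Function.update_of_ne hij.symm, Function.update_of_ne hik.symm,
          Function.update_of_ne hil.symm])
    rw [hmean', zero_mul] at this
    rw [Finset.expect_congr rfl fun s _ => show s i * star (s j) * s k * star (s l)
      = star (s j) * (s i * s k * star (s l)) by ring, this]
    simp [hij.symm, hik.symm]
  by_cases hij : i = j
  · subst hij
    by_cases hik : i = k
    · subst hik
      by_cases hil : i = l
      · subst hil
        rw [single i (fun z => z * star z * z * star z), hκ']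
        simp; ring
      · have := expect_piFinset_mul S l (fun z => star z)
          (fun s : ι → ℂ => s i * star (s i) * s i) (fun s t => by
            simp [Function.update_of_ne hil])
        rw [hmean', zero_mul] at this
        rw [Finset.expect_congr rfl fun s _ => show s i * star (s i) * s i * star (s l)
          = star (s l) * (s i * star (s i) * s i) by ring, this]
        simp [hil]
    · by_cases hkl : k = l
      · subst hkl
        have := expect_piFinset_mul S i (fun z => z * star z)
          (fun s : ι → ℂ => s k * star (s k)) (fun s t => by
            simp [Function.update_of_ne (Ne.symm hik)])
        rw [hpow', one_mul, single k (fun z => z * star z), hpow'] at this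
        simp only [mul_assoc] at this ⊢
        rw [this]; simp [hik]
      · have := expect_piFinset_mul S k (fun z => z)
          (fun s : ι → ℂ => s i * star (s i) * star (s l)) (fun s t => by
            simp [Function.update_of_ne hik, Function.update_of_ne (Ne.symm hkl)])
        rw [hmean, zero_mul] at this
        rw [Finset.expect_congr rfl fun s _ => show s i * star (s i) * s k * star (s l)
          = s k * (s i * star (s i) * star (s l)) by ring, this]
        by_cases hil : i = l <;> simp [hik, hkl, Ne.symm hik]
  · by_cases hik : i = k
    · subst hik
      have hjl : j = l := by
        by_contra h
        exact hj ⟨Ne.symm hij, Ne.symm hij, h⟩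
      subst hjl
      have := expect_piFinset_mul S i (fun z => z ^ 2)
          (fun s : ι → ℂ => star (s j) * star (s j)) (fun s t => by
            simp [Function.update_of_ne (Ne.symm hij)])
      rw [hpseudo, zero_mul] at this
      rw [Finset.expect_congr rfl fun s _ => show s i * star (s j) * s i * star (s j)
          = s i ^ 2 * (star (s j) * star (s j)) by ring, this]
      simp [hij]
    · have hil : i = l := by
        by_contra h
        exact hi ⟨hij, hik, h⟩
      subst hil
      have hjk : j = k := by
        by_contra h
        exact hj ⟨Ne.symm hij, h, Ne.symm hij⟩
      subst hjk
      have := expect_piFinset_mul S i (fun z => z * star z)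
          (fun s : ι → ℂ => s j * star (s j)) (fun s t => by
            simp [Function.update_of_ne (Ne.symm hij)])
      rw [hpow', one_mul, single j (fun z => z * star z), hpow'] at this
      rw [Finset.expect_congr rfl fun s _ => show s i * star (s j) * s j * star (s i)
          = s i * star (s i) * (s j * star (s j)) by ring, this]
      simp [hij]

end QuadraticForms

/-! ### Second-order statistics of the received power spectrum -/

/-- The power `|(V s)_n|²` received in frequency bin `n` when `V` maps the symbols to the
frequency domain. -/
def binPower {ι : Type*} [Fintype ι] (V : Matrix ι ι ℂ) (s : ι → ℂ) (n : ι) : ℝ :=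
  ‖(V *ᵥ s) n‖ ^ 2

lemma ofReal_binPower {ι : Type*} [Fintype ι] (V : Matrix ι ι ℂ) (s : ι → ℂ) (n : ι) :
    (binPower V s n : ℂ) = (V *ᵥ s) n * star ((V *ᵥ s) n) := by
  rw [binPower, Complex.star_def, Complex.mul_conj, Complex.normSq_eq_norm_sq]

section BinPowers

variable {ι : Type*} [Fintype ι] [DecidableEq ι] {S : Finset ℂ} {B : ℝ}

lemma expect_two_symbols (hmean : 𝔼 s ∈ S, s = 0) (hpower : 𝔼 s ∈ S, ‖s‖ ^ 2 = 1) (i j : ι) :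
    𝔼 s ∈ Fintype.piFinset (fun _ : ι => S), s i * star (s j) = if i = j then (1 : ℂ) else 0 := by
  have hS : S.Nonempty := symbols_nonempty hpower
  have hP : (Fintype.piFinset (fun _ : ι => S)).Nonempty :=
    Fintype.piFinset_nonempty.2 fun _ => hS
  by_cases hij : i = j
  · subst hij
    have h1 := expect_piFinset_mul S i (fun z => z * star z) (fun _ : ι → ℂ => (1 : ℂ))
      (fun _ _ => rfl)
    have h2 : (𝔼 s ∈ S, ((‖s‖ ^ 2 : ℝ) : ℂ)) = ((𝔼 s ∈ S, ‖s‖ ^ 2 : ℝ) : ℂ) :=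
      (map_expect (Complex.ofRealHom) (fun s : ℂ => ‖s‖ ^ 2) S).symm
    rw [Finset.expect_const hP, mul_one] at h1
    simp only [mul_one] at h1
    rw [h1, if_pos rfl, ← Complex.ofReal_one, ← hpower, ← h2]
    refine Finset.expect_congr rfl fun s _ => ?_
    rw [Complex.star_def, Complex.mul_conj, Complex.normSq_eq_norm_sq]
  · have := expect_piFinset_mul S i (fun z => z) (fun s : ι → ℂ => star (s j)) (fun s t => by
        simp [Function.update_of_ne (Ne.symm hij)])
    rw [this, hmean, zero_mul, if_neg hij]

lemma sum_row_mul_star {V : Matrix ι ι ℂ} (hV : V ∈ Matrix.unitaryGroup ι ℂ) (n m : ι) :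
    ∑ i, V n i * star (V m i) = if n = m then (1 : ℂ) else 0 := by
  have := congrFun (congrFun (Matrix.mem_unitaryGroup_iff.1 hV) n) m
  simpa [Matrix.mul_apply, Matrix.one_apply] using this

lemma sum_row_power {V : Matrix ι ι ℂ} (hV : V ∈ Matrix.unitaryGroup ι ℂ) (n : ι) :
    ∑ i, ‖V n i‖ ^ 2 = 1 := by
  have h := sum_row_mul_star hV n n
  simp only [Complex.star_def, Complex.mul_conj, Complex.normSq_eq_norm_sq, if_true] at h
  exact_mod_cast h

lemma sum_col_power {V : Matrix ι ι ℂ} (hV : V ∈ Matrix.unitaryGroup ι ℂ) (i : ι) :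
    ∑ n, ‖V n i‖ ^ 2 = 1 := by
  have h := congrFun (congrFun (Matrix.mem_unitaryGroup_iff'.1 hV) i) i
  simp only [Matrix.mul_apply, Matrix.star_apply, Complex.star_def, mul_comm, Complex.mul_conj,
    Complex.normSq_eq_norm_sq, Matrix.one_apply_eq] at h
  exact_mod_cast h

lemma expect_binPower (hmean : 𝔼 s ∈ S, s = 0) (hpower : 𝔼 s ∈ S, ‖s‖ ^ 2 = 1)
    {V : Matrix ι ι ℂ} (hV : V ∈ Matrix.unitaryGroup ι ℂ) (n : ι) :
    𝔼 s ∈ Fintype.piFinset (fun _ : ι => S), binPower V s n = 1 := by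
  have h : ((𝔼 s ∈ Fintype.piFinset (fun _ : ι => S), binPower V s n : ℝ) : ℂ) = 1 := by
    rw [show ((𝔼 s ∈ Fintype.piFinset (fun _ : ι => S), binPower V s n : ℝ) : ℂ) = _ from
      map_expect Complex.ofRealHom _ _]
    calc 𝔼 s ∈ Fintype.piFinset (fun _ : ι => S), ((binPower V s n : ℝ) : ℂ)
        = 𝔼 s ∈ Fintype.piFinset (fun _ : ι => S),
            ∑ i, ∑ j, V n i * star (V n j) * (s i * star (s j)) := by
          refine Finset.expect_congr rfl fun s _ => ?_
          rw [ofReal_binPower, Matrix.mulVec, dotProduct, star_sum, Finset.sum_mul_sum]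
          refine Finset.sum_congr rfl fun i _ => Finset.sum_congr rfl fun j _ => ?_
          rw [star_mul']; ring
      _ = ∑ i, ∑ j, V n i * star (V n j) * (if i = j then 1 else 0) := by
          simp only [Finset.expect_sum_comm, ← Finset.mul_expect,
            expect_two_symbols hmean hpower]
      _ = 1 := by
          simp only [mul_ite, mul_one, mul_zero, Finset.sum_ite_eq, Finset.mem_univ, if_true]
          rw [sum_row_mul_star hV, if_pos rfl]
  exact_mod_cast h

/-- The covariance of the bin powers: the identity, minus `2 - κ` times the Gram matrix of the
power spectra of the columns of `V`. -/
lemma expect_binPower_covariance (hmean : 𝔼 s ∈ S, s = 0) (hpower : 𝔼 s ∈ S, ‖s‖ ^ 2 = 1)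
    (hpseudo : 𝔼 s ∈ S, s ^ 2 = 0) (κ : ℝ) (hκ : 𝔼 s ∈ S, ‖s‖ ^ 4 = κ)
    {V : Matrix ι ι ℂ} (hV : V ∈ Matrix.unitaryGroup ι ℂ) (n m : ι) :
    𝔼 s ∈ Fintype.piFinset (fun _ : ι => S), (binPower V s n - 1) * (binPower V s m - 1) =
      (if n = m then 1 else 0) - (2 - κ) * ∑ i, ‖V n i‖ ^ 2 * ‖V m i‖ ^ 2 := by
  have hS : S.Nonempty := symbols_nonempty hpower
  have hP : (Fintype.piFinset (fun _ : ι => S)).Nonempty :=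
    Fintype.piFinset_nonempty.2 fun _ => hS
  have h : ((𝔼 s ∈ Fintype.piFinset (fun _ : ι => S), binPower V s n * binPower V s m : ℝ) : ℂ)
      = ((1 + (if n = m then 1 else 0) - (2 - κ) * ∑ i, ‖V n i‖ ^ 2 * ‖V m i‖ ^ 2 : ℝ) : ℂ) := by
    rw [show ((𝔼 s ∈ Fintype.piFinset (fun _ : ι => S), binPower V s n * binPower V s m : ℝ) : ℂ)
      = _ from map_expect Complex.ofRealHom _ _]
    calc 𝔼 s ∈ Fintype.piFinset (fun _ : ι => S), ((binPower V s n * binPower V s m : ℝ) : ℂ)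
        = 𝔼 s ∈ Fintype.piFinset (fun _ : ι => S), ∑ i, ∑ j, ∑ k, ∑ l,
            V n i * star (V n j) * V m k * star (V m l)
              * (s i * star (s j) * s k * star (s l)) := by
          refine Finset.expect_congr rfl fun s _ => ?_
          rw [Complex.ofReal_mul, ofReal_binPower, ofReal_binPower]
          simp only [Matrix.mulVec, dotProduct, star_sum]
          rw [Finset.sum_mul_sum, Finset.sum_mul_sum, Finset.sum_mul_sum]
          refine Finset.sum_congr rfl fun i _ => ?_
          simp only [Finset.sum_mul_sum]
          rw [Finset.sum_comm]
          refine Finset.sum_congr rfl fun j _ => Finset.sum_congr rfl fun k _ =>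
            Finset.sum_congr rfl fun l _ => ?_
          rw [star_mul', star_mul']; ring
      _ = ∑ i, ∑ j, ∑ k, ∑ l, V n i * star (V n j) * V m k * star (V m l)
            * ((if i = j then if k = l then (1 : ℂ) else 0 else 0)
              + (if i = l then if k = j then 1 else 0 else 0)
              + (if i = j then if i = k then if i = l then (κ : ℂ) - 2 else 0 else 0 else 0)) := by
          simp only [Finset.expect_sum_comm, ← Finset.mul_expect,
            expect_four_symbols hmean hpower hpseudo κ hκ]
      _ = (∑ i, V n i * star (V n i)) * (∑ k, V m k * star (V m k))
            + (∑ i, V n i * star (V m i)) * (∑ k, V m k * star (V n k))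
            + (κ - 2) * ∑ i, (V n i * star (V n i)) * (V m i * star (V m i)) := by
          simp only [mul_add, Finset.sum_add_distrib]
          congr 1
          · congr 1
            · rw [Finset.sum_mul_sum]
              simp only [mul_ite, mul_one, mul_zero, Finset.sum_ite_eq, Finset.mem_univ, if_true,
                Finset.sum_ite_irrel, Finset.sum_const_zero]
              refine Finset.sum_congr rfl fun i _ => Finset.sum_congr rfl fun j _ => ?_
              ring
            · rw [Finset.sum_mul_sum]
              simp only [mul_ite, mul_one, mul_zero, Finset.sum_ite_eq, Finset.sum_ite_eq',
                Finset.mem_univ, if_true]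
              refine Finset.sum_congr rfl fun i _ => Finset.sum_congr rfl fun j _ => ?_
              ring
          · rw [Finset.mul_sum]
            simp only [mul_ite, mul_zero, Finset.sum_ite_eq, Finset.mem_univ, if_true,
                Finset.sum_ite_irrel, Finset.sum_const_zero]
            refine Finset.sum_congr rfl fun i _ => ?_
            ring
      _ = _ := by
          simp only [sum_row_mul_star hV, if_true]
          have hc : ∀ z : ℂ, z * star z = ((‖z‖ ^ 2 : ℝ) : ℂ) := by
            intro z
            rw [Complex.star_def, Complex.mul_conj, Complex.normSq_eq_norm_sq]
          simp only [hc]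
          by_cases hnm : n = m
          · subst hnm; push_cast; simp; ring
          · push_cast; simp [hnm, Ne.symm hnm]; ring
  have h' := Complex.ofReal_injective h
  have e : ∀ s, (binPower V s n - 1) * (binPower V s m - 1)
      = binPower V s n * binPower V s m - binPower V s n - binPower V s m + 1 := fun s => by ring
  simp only [e, Finset.expect_add_distrib, Finset.expect_sub_distrib, h',
    expect_binPower hmean hpower hV, Finset.expect_const hP]
  ring

/-- Fourth moments of weighted sums of the power fluctuations, uniformly in the unitary `V`. -/
lemma expect_weighted_binPower_pow_four (hmean : 𝔼 s ∈ S, s = 0) (hpower : 𝔼 s ∈ S, ‖s‖ ^ 2 = 1)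
    (hB : ∀ s ∈ S, ‖s‖ ≤ B) (hB1 : 1 ≤ B)
    {V : Matrix ι ι ℂ} (hV : V ∈ Matrix.unitaryGroup ι ℂ) (w : ι → ℝ) :
    𝔼 s ∈ Fintype.piFinset (fun _ : ι => S), (∑ n, w n * (binPower V s n - 1)) ^ 4 ≤
      (400 * B ^ 4 * ∑ n, w n ^ 2) ^ 2 := by
  set D : Matrix ι ι ℂ := Matrix.diagonal fun n => (w n : ℂ) with hD
  have hDD : Dᴴ = D := by
    rw [hD, Matrix.diagonal_conjTranspose]
    congr 1; funext n; simp
  set A : Matrix ι ι ℂ := Vᴴ * D * V with hA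
  have hherm : A.IsHermitian := by
    rw [Matrix.IsHermitian, hA]
    simp only [Matrix.conjTranspose_mul, Matrix.conjTranspose_conjTranspose, hDD, Matrix.mul_assoc]
  have hVV : V * Vᴴ = 1 := Matrix.mem_unitaryGroup_iff.1 hV
  have htr : ∑ i, (A i i).re = ∑ n, w n := by
    have : A.trace = ∑ n, (w n : ℂ) := by
      rw [hA, Matrix.trace_mul_comm, ← Matrix.mul_assoc, hVV, Matrix.one_mul, hD,
        Matrix.trace_diagonal]
    rw [← Complex.re_sum]
    change A.trace.re = _
    rw [this]; simp
  have hfrob : ∑ i, ∑ j, ‖A i j‖ ^ 2 = ∑ n, w n ^ 2 := by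
    have h1 : (A * Aᴴ).trace = ∑ n, ((w n ^ 2 : ℝ) : ℂ) := by
      rw [hherm.eq, hA]
      rw [show Vᴴ * D * V * (Vᴴ * D * V) = Vᴴ * D * (V * Vᴴ) * (D * V) by
        simp only [Matrix.mul_assoc], hVV, Matrix.mul_one, Matrix.mul_assoc, Matrix.trace_mul_comm,
        Matrix.mul_assoc, Matrix.mul_assoc, hVV, Matrix.mul_one, hD, Matrix.diagonal_mul_diagonal,
        Matrix.trace_diagonal]
      simp [sq]
    have h2 : (A * Aᴴ).trace = ((∑ i, ∑ j, ‖A i j‖ ^ 2 : ℝ) : ℂ) := by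
      simp only [Matrix.trace, Matrix.diag_apply, Matrix.mul_apply, Matrix.conjTranspose_apply,
        Complex.star_def, Complex.mul_conj, Complex.normSq_eq_norm_sq]
      push_cast; rfl
    rw [h2] at h1
    exact_mod_cast h1
  have hquad : ∀ s : ι → ℂ, (∑ i, ∑ j, star (s i) * A i j * s j).re - ∑ i, (A i i).re
      = ∑ n, w n * (binPower V s n - 1) := by
    intro s
    have : ∑ i, ∑ j, star (s i) * A i j * s j = ∑ n, ((w n * binPower V s n : ℝ) : ℂ) := by
      calc ∑ i, ∑ j, star (s i) * A i j * s j = star s ⬝ᵥ (A *ᵥ s) := by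
            simp only [dotProduct, Matrix.mulVec, Finset.mul_sum, Pi.star_apply, mul_assoc]
        _ = star (V *ᵥ s) ⬝ᵥ (D *ᵥ (V *ᵥ s)) := by
            rw [Matrix.star_mulVec, ← Matrix.dotProduct_mulVec, Matrix.mulVec_mulVec,
              Matrix.mulVec_mulVec]
        _ = _ := by
            simp only [dotProduct, hD, Matrix.mulVec_diagonal, Pi.star_apply]
            refine Finset.sum_congr rfl fun n _ => ?_
            rw [Complex.ofReal_mul, ofReal_binPower]; ring
    rw [this, htr, ← Complex.ofReal_sum, Complex.ofReal_re, ← Finset.sum_sub_distrib]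
    exact Finset.sum_congr rfl fun n _ => by ring
  have := expect_quadratic_pow_four hmean hpower hB hB1 A hherm Finset.univ
  simpa only [hquad, hfrob] using this

end BinPowers

/-! ### The Fisher information as a sum over frequency bins -/

lemma dftMatrix_apply_eq_pow {N : ℕ} (m n : Fin N) :
    dftMatrix N m n = (1 / (Real.sqrt N : ℂ)) *
      (Complex.exp (2 * Real.pi * Complex.I / N))⁻¹ ^ ((m : ℕ) * (n : ℕ)) := by
  rw [dftMatrix, Matrix.of_apply, ← Complex.exp_neg, ← Complex.exp_nat_mul]
  congr 2
  push_cast; ring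

/-- The DFT matrix is unitary. -/
lemma dftMatrix_mem_unitaryGroup {N : ℕ} (hN : 0 < N) :
    dftMatrix N ∈ Matrix.unitaryGroup (Fin N) ℂ := by
  rw [Matrix.mem_unitaryGroup_iff]
  have hζ := (Complex.isPrimitiveRoot_exp N hN.ne').inv
  set ω := (Complex.exp (2 * Real.pi * Complex.I / N))⁻¹ with hω
  have hω0 : ω ≠ 0 := inv_ne_zero (Complex.exp_ne_zero _)
  have hωstar : star ω = ω⁻¹ := by
    have h1 : ‖ω‖ = 1 := hζ.norm'_eq_one hN.ne'
    rw [Complex.inv_def, Complex.normSq_eq_norm_sq, h1]; simp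
  have hsq : (1 / (Real.sqrt N : ℂ)) * (1 / (Real.sqrt N : ℂ)) = 1 / N := by
    rw [div_mul_div_comm, one_mul, ← Complex.ofReal_mul, Real.mul_self_sqrt (Nat.cast_nonneg N)]
    simp
  clear_value ω
  ext m m'
  rw [Matrix.mul_apply]
  have hterm : ∀ n : Fin N, dftMatrix N m n * (star (dftMatrix N)) n m'
      = 1 / N * (ω ^ (m : ℕ) * (ω ^ (m' : ℕ))⁻¹) ^ (n : ℕ) := by
    intro n
    rw [Matrix.star_apply, dftMatrix_apply_eq_pow, dftMatrix_apply_eq_pow, ← hω]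
    rw [star_mul', star_pow, hωstar]
    have : star (1 / (Real.sqrt N : ℂ)) = 1 / (Real.sqrt N : ℂ) := by
      rw [← Complex.ofReal_one, ← Complex.ofReal_div]; exact Complex.conj_ofReal _
    rw [this, mul_mul_mul_comm, hsq, mul_pow, inv_pow, inv_pow, ← pow_mul, ← pow_mul]
  rw [Finset.sum_congr rfl fun n _ => hterm n, ← Finset.mul_sum,
    Fin.sum_univ_eq_sum_range (fun n => (ω ^ (m : ℕ) * (ω ^ (m' : ℕ))⁻¹) ^ n) N]
  have hNC : (N : ℂ) ≠ 0 := by exact_mod_cast hN.ne'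
  by_cases hm : m = m'
  · subst hm
    rw [mul_inv_cancel₀ (pow_ne_zero _ hω0)]
    simp [hNC]
  · rw [Matrix.one_apply_ne hm]
    have hr1 : ω ^ (m : ℕ) * (ω ^ (m' : ℕ))⁻¹ ≠ 1 := by
      intro h
      rw [mul_inv_eq_one₀ (pow_ne_zero _ hω0)] at h
      exact hm (Fin.ext (hζ.pow_inj m.2 m'.2 h))
    have hrN : (ω ^ (m : ℕ) * (ω ^ (m' : ℕ))⁻¹) ^ N = 1 := by
      rw [mul_pow, inv_pow, pow_right_comm ω m, pow_right_comm ω m', hζ.pow_eq_one]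
      simp
    rw [geom_sum_eq hr1, hrN]; simp

/-- The unit-amplitude response `e^{-2πi f τ}` at normalized frequency `f` and delay `τ`. -/
def phase (τ f : ℝ) : ℂ := Complex.exp (-(2 * Real.pi * Complex.I * f * τ))

/-- The derivatives, with respect to the parameters, of the frequency response
`∑ β_l e^{-2πi f τ_l}` of the targets at normalized frequency `f`. -/
def response {L : ℕ} (τ : Fin L → ℝ) (β : Fin L → ℂ) (f : ℝ) : Param L → ℂ :=
  Sum.elim (fun l => β l * (-(2 * Real.pi * Complex.I * f)) * phase (τ l) f)
    (Sum.elim (fun l => phase (τ l) f) fun l => Complex.I * phase (τ l) f)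

/-- The Fisher information contributed by a bin of unit power at normalized frequency `f`. -/
def infoDensity {L : ℕ} (σ : ℝ) (τ : Fin L → ℝ) (β : Fin L → ℂ) (f : ℝ) :
    Matrix (Param L) (Param L) ℝ :=
  Matrix.of fun k l => 2 / σ ^ 2 * (star (response τ β f k) * response τ β f l).re

lemma delayMatrix_mulVec {N : ℕ} (t : ℝ) (x : Fin N → ℂ) :
    delayMatrix N t *ᵥ x =
      (dftMatrix N)ᴴ *ᵥ fun n => phase t (freq n) * (dftMatrix N *ᵥ x) n := by
  rw [delayMatrix, ← Matrix.mulVec_mulVec, ← Matrix.mulVec_mulVec]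
  congr 1
  funext n
  rw [Matrix.mulVec_diagonal, phase, freq]
  congr 2
  push_cast; ring

lemma meanSignal_eq {L N : ℕ} (x : Fin N → ℂ) (θ : Param L → ℝ) :
    meanSignal x θ = (dftMatrix N)ᴴ *ᵥ fun n =>
      (∑ l : Fin L, ((θ (.inr (.inl l)) : ℂ) + (θ (.inr (.inr l)) : ℂ) * Complex.I) *
        phase (θ (.inl l)) (freq n)) * (dftMatrix N *ᵥ x) n := by
  rw [meanSignal]
  simp only [delayMatrix_mulVec, ← Matrix.mulVec_smul]
  rw [← Matrix.mulVec_sum]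
  congr 1
  funext n
  simp only [Finset.sum_apply, Pi.smul_apply, smul_eq_mul, Finset.sum_mul, mul_assoc]

lemma hasDerivAt_phase (f t : ℝ) :
    HasDerivAt (fun t : ℝ => phase t f) (-(2 * Real.pi * Complex.I * f) * phase t f) t := by
  unfold phase
  have h1 : HasDerivAt (fun t : ℝ => -(2 * Real.pi * Complex.I * f * (t : ℂ)))
      (-(2 * Real.pi * Complex.I * f * 1)) t :=
    ((Complex.ofRealCLM.hasDerivAt (x := t)).const_mul (2 * Real.pi * Complex.I * (f : ℂ))).neg
  convert h1.cexp using 1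
  ring

/-- The derivatives of the frequency response of the targets. -/
lemma hasDerivAt_frequencyResponse {L : ℕ} (τ : Fin L → ℝ) (β : Fin L → ℂ) (f : ℝ) (k : Param L) :
    HasDerivAt (fun t : ℝ => ∑ l : Fin L,
      ((Function.update (paramVec τ β) k t (.inr (.inl l)) : ℂ)
        + (Function.update (paramVec τ β) k t (.inr (.inr l)) : ℂ) * Complex.I) *
        phase (Function.update (paramVec τ β) k t (.inl l)) f) (response τ β f k)
      (paramVec τ β k) := by
  have hsingle : ∀ (a : Fin L) (F : Fin L → ℝ → ℂ) (F' : ℂ) (t₀ : ℝ), HasDerivAt (F a) F' t₀ →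
      (∀ l, l ≠ a → HasDerivAt (F l) 0 t₀) → HasDerivAt (fun t => ∑ l, F l t) F' t₀ := by
    intro a F F' t₀ ha hl
    have := HasDerivAt.fun_sum (u := Finset.univ) (A := F) (A' := fun l => if l = a then F' else 0)
      (x := t₀) (fun l _ => by
        by_cases h : l = a
        · subst h; simpa using ha
        · simpa [h] using hl l h)
    simpa using this
  have hβ : ∀ l, ((β l).re : ℂ) + ((β l).im : ℂ) * Complex.I = β l := fun l => Complex.re_add_im _
  have hid : ∀ t : ℝ, HasDerivAt (fun t : ℝ => (t : ℂ)) 1 t := fun t =>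
    Complex.ofRealCLM.hasDerivAt
  rcases k with a | a | a
  · refine hsingle a _ _ _ ?_ fun l hl => ?_
    · simp only [Function.update_self, ne_eq, reduceCtorEq, not_false_eq_true,
        Function.update_of_ne, paramVec, Sum.elim_inr, Sum.elim_inl, hβ, response]
      rw [mul_assoc]
      exact (hasDerivAt_phase f (τ a)).const_mul (β a)
    · simp only [ne_eq, reduceCtorEq, not_false_eq_true, Sum.inl.injEq, hl,
        Function.update_of_ne]
      exact hasDerivAt_const _ _
  · refine hsingle a _ _ _ ?_ fun l hl => ?_
    · simp only [Function.update_self, ne_eq, reduceCtorEq, not_false_eq_true, Sum.inr.injEq,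
        Function.update_of_ne, paramVec, Sum.elim_inr, Sum.elim_inl, response]
      simpa using ((hid (β a).re).add_const (((β a).im : ℂ) * Complex.I)).mul_const
        (phase (τ a) f)
    · simp only [ne_eq, reduceCtorEq, not_false_eq_true, Sum.inl.injEq, Sum.inr.injEq, hl,
        Function.update_of_ne]
      exact hasDerivAt_const _ _
  · refine hsingle a _ _ _ ?_ fun l hl => ?_
    · simp only [Function.update_self, ne_eq, reduceCtorEq, not_false_eq_true, Sum.inr.injEq,
        Function.update_of_ne, paramVec, Sum.elim_inr, Sum.elim_inl, response]
      simpa using (((hid (β a).im).mul_const Complex.I).const_add ((β a).re : ℂ)).mul_const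
        (phase (τ a) f)
    · simp only [ne_eq, reduceCtorEq, not_false_eq_true, Sum.inr.injEq, hl,
        Function.update_of_ne]
      exact hasDerivAt_const _ _

lemma partialMean_eq {L N : ℕ} (τ : Fin L → ℝ) (β : Fin L → ℂ) (x : Fin N → ℂ) (k : Param L) :
    partialMean x (paramVec τ β) k =
      (dftMatrix N)ᴴ *ᵥ fun n => response τ β (freq n) k * (dftMatrix N *ᵥ x) n := by
  rw [partialMean]
  simp only [meanSignal_eq]
  refine HasDerivAt.deriv ?_
  rw [hasDerivAt_pi]
  intro i
  simp only [Matrix.mulVec, dotProduct]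
  refine HasDerivAt.fun_sum fun n _ => ?_
  exact ((hasDerivAt_frequencyResponse τ β (freq n) k).mul_const _).const_mul _

/-- The Fisher information matrix is linear in the bin powers. -/
lemma fim_eq_sum {L N : ℕ} (hN : 0 < N) (σ : ℝ) (τ : Fin L → ℝ) (β : Fin L → ℂ)
    (U : Matrix (Fin N) (Fin N) ℂ) (s : Fin N → ℂ) :
    fim σ τ β U s =
      ∑ n, binPower (dftMatrix N * U) s n • infoDensity σ τ β (freq n) := by
  ext k l
  have hF := Matrix.mem_unitaryGroup_iff.1 (dftMatrix_mem_unitaryGroup hN)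
  have hdot : ∀ a b : Fin N → ℂ,
      star ((dftMatrix N)ᴴ *ᵥ a) ⬝ᵥ ((dftMatrix N)ᴴ *ᵥ b) = star a ⬝ᵥ b := by
    intro a b
    rw [Matrix.star_mulVec, ← Matrix.dotProduct_mulVec, Matrix.mulVec_mulVec,
      Matrix.conjTranspose_conjTranspose, ← Matrix.star_eq_conjTranspose, hF, Matrix.one_mulVec]
  rw [fim, Matrix.of_apply, partialMean_eq, partialMean_eq, hdot, Matrix.sum_apply, dotProduct,
    Complex.re_sum, Finset.mul_sum]
  refine Finset.sum_congr rfl fun n _ => ?_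
  rw [Matrix.smul_apply, infoDensity, Matrix.of_apply, smul_eq_mul, Matrix.mulVec_mulVec]
  have h : star (response τ β (freq n) k * ((dftMatrix N * U) *ᵥ s) n)
        * (response τ β (freq n) l * ((dftMatrix N * U) *ᵥ s) n)
      = (binPower (dftMatrix N * U) s n : ℂ)
        * (star (response τ β (freq n) k) * response τ β (freq n) l) := by
    rw [ofReal_binPower, star_mul']; ring
  rw [Pi.star_apply, h, Complex.re_ofReal_mul]
  ring

/-- The Fisher information averaged over the symbols, which is the same for all unitary
waveforms. -/
def avgInfo {L : ℕ} (σ : ℝ) (τ : Fin L → ℝ) (β : Fin L → ℂ) (N : ℕ) :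
    Matrix (Param L) (Param L) ℝ :=
  ∑ n : Fin N, infoDensity σ τ β (freq n)

lemma meanFim_eq_avgInfo {L N : ℕ} (hN : 0 < N) {S : Finset ℂ} (hmean : 𝔼 s ∈ S, s = 0)
    (hpower : 𝔼 s ∈ S, ‖s‖ ^ 2 = 1) (σ : ℝ) (τ : Fin L → ℝ) (β : Fin L → ℂ)
    {U : Matrix (Fin N) (Fin N) ℂ} (hU : U ∈ Matrix.unitaryGroup (Fin N) ℂ) :
    meanFim S σ τ β U = avgInfo σ τ β N := by
  have hV : dftMatrix N * U ∈ Matrix.unitaryGroup (Fin N) ℂ :=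
    mul_mem (dftMatrix_mem_unitaryGroup hN) hU
  rw [meanFim, avgInfo]
  simp only [fim_eq_sum hN, Finset.expect_sum_comm]
  refine Finset.sum_congr rfl fun n _ => ?_
  ext k l
  have h : (𝔼 s ∈ symbolVectors S N, binPower (dftMatrix N * U) s n •
      infoDensity σ τ β (freq n)) k l
      = 𝔼 s ∈ symbolVectors S N, binPower (dftMatrix N * U) s n * infoDensity σ τ β (freq n) k l :=
    map_expect ((Matrix.entryLinearMap ℝ ℝ k l).restrictScalars ℚ≥0) _ _
  rw [h, ← Finset.expect_mul]
  change (𝔼 s ∈ Fintype.piFinset (fun _ => S), _) * _ = _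
  rw [expect_binPower hmean hpower hV, one_mul]

lemma ofdm_mem_unitaryGroup {N : ℕ} (hN : 0 < N) : ofdm N ∈ Matrix.unitaryGroup (Fin N) ℂ := by
  rw [ofdm, ← Matrix.star_eq_conjTranspose]
  exact Unitary.star_mem (dftMatrix_mem_unitaryGroup hN)

lemma dftMatrix_mul_ofdm {N : ℕ} (hN : 0 < N) : dftMatrix N * ofdm N = 1 :=
  Matrix.mem_unitaryGroup_iff.1 (dftMatrix_mem_unitaryGroup hN)

/-! ### Coercivity of the averaged Fisher information -/

/-- Functions `(c + d f) e^{λ f}` with distinct `λ` are linearly independent on `(0, 1)`: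
differentiation turns a vanishing combination into the vanishing of
`P ↦ ∑ c P(λ) + d (P'(λ) + f P(λ))` on all polynomials `P`, and polynomials separate values and
first derivatives at distinct points. -/
lemma eq_zero_of_sum_affine_mul_exp_eq_zero {ι : Type*} [Fintype ι] {ν : ι → ℂ}
    (hν : Function.Injective ν) (c d : ι → ℂ)
    (h : ∀ f ∈ Set.Ioo (0 : ℝ) 1, ∑ l, (c l + d l * f) * Complex.exp (ν l * f) = 0) :
    c = 0 ∧ d = 0 := by
  classical
  have key : ∀ P : Polynomial ℂ, ∀ f ∈ Set.Ioo (0 : ℝ) 1,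
      ∑ l, (c l * P.eval (ν l) + d l * (P.derivative.eval (ν l) + f * P.eval (ν l)))
        * Complex.exp (ν l * f) = 0 := by
    intro P
    induction P using Polynomial.induction_on with
    | C a =>
      intro f hf
      rw [← mul_zero a, ← h f hf, Finset.mul_sum]
      refine Finset.sum_congr rfl fun l _ => ?_
      simp; ring
    | add p q hp hq =>
      intro f hf
      refine Eq.trans ?_ ((congrArg₂ (· + ·) (hp f hf) (hq f hf)).trans (add_zero 0))
      rw [← Finset.sum_add_distrib]
      refine Finset.sum_congr rfl fun l _ => ?_
      simp; ring
    | monomial n a ih =>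
      intro f hf
      set P : Polynomial ℂ := Polynomial.C a * Polynomial.X ^ n with hP
      have hPX : Polynomial.C a * Polynomial.X ^ (n + 1) = Polynomial.X * P := by
        rw [hP, pow_succ]; ring
      rw [hPX]
      have hderiv : HasDerivAt (fun f : ℝ => ∑ l,
          (c l * P.eval (ν l) + d l * (P.derivative.eval (ν l) + f * P.eval (ν l)))
            * Complex.exp (ν l * f))
          (∑ l, (c l * (Polynomial.X * P).eval (ν l) + d l *
            ((Polynomial.X * P).derivative.eval (ν l) + f * (Polynomial.X * P).eval (ν l)))
            * Complex.exp (ν l * f)) f := by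
        refine HasDerivAt.fun_sum fun l _ => ?_
        have hid : HasDerivAt (fun f : ℝ => (f : ℂ)) 1 f := Complex.ofRealCLM.hasDerivAt
        have h1 := (((hid.mul_const (P.eval (ν l))).const_add
          (P.derivative.eval (ν l))).const_mul (d l)).const_add (c l * P.eval (ν l))
        have h2 := (hid.const_mul (ν l)).cexp
        refine (h1.mul h2).congr_deriv ?_
        simp only [Polynomial.derivative_mul, Polynomial.derivative_X, Polynomial.eval_add,
          Polynomial.eval_mul, Polynomial.eval_X, Polynomial.eval_one]
        ring
      have hzero : HasDerivAt (fun f : ℝ => ∑ l,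
          (c l * P.eval (ν l) + d l * (P.derivative.eval (ν l) + f * P.eval (ν l)))
            * Complex.exp (ν l * f)) 0 f := by
        refine (hasDerivAt_const f (0 : ℂ)).congr_of_eventuallyEq ?_
        filter_upwards [isOpen_Ioo.mem_nhds hf] with g hg using ih g hg
      exact hderiv.unique hzero
  have hhalf : (1 / 2 : ℝ) ∈ Set.Ioo (0 : ℝ) 1 := by constructor <;> norm_num
  set R : ι → Polynomial ℂ := fun l =>
    ∏ j ∈ Finset.univ.erase l, (Polynomial.X - Polynomial.C (ν j)) with hR
  have hRne : ∀ l j, j ≠ l → (R l).eval (ν j) = 0 := by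
    intro l j hj
    rw [hR, Polynomial.eval_prod]
    exact Finset.prod_eq_zero (Finset.mem_erase.2 ⟨hj, Finset.mem_univ j⟩) (by simp)
  have hRl : ∀ l, (R l).eval (ν l) ≠ 0 := by
    intro l
    rw [hR, Polynomial.eval_prod, Finset.prod_ne_zero_iff]
    intro j hj
    simp only [Polynomial.eval_sub, Polynomial.eval_X, Polynomial.eval_C]
    exact sub_ne_zero.2 fun h => (Finset.mem_erase.1 hj).1 (hν h).symm
  have hd : d = 0 := by
    funext l
    have := key ((Polynomial.X - Polynomial.C (ν l)) * R l ^ 2) _ hhalf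
    rw [Finset.sum_eq_single l] at this
    · simpa [Complex.exp_ne_zero, hRl l] using this
    · intro j _ hj
      simp [hRne l j hj, Polynomial.derivative_pow]
    · simp
  refine ⟨?_, hd⟩
  funext l
  have := key (R l) _ hhalf
  rw [Finset.sum_eq_single l] at this
  · simpa [Complex.exp_ne_zero, hRl l, hd] using this
  · intro j _ hj
    simp [hRne l j hj, hd]
  · simp

section Coercivity

variable {L : ℕ} (σ : ℝ) (τ : Fin L → ℝ) (β : Fin L → ℂ)

/-- The responses to the real parameters are linearly independent over `ℝ` on `(0, 1)`. -/
lemma eq_zero_of_sum_response_eq_zero {τ : Fin L → ℝ} (hτ : Function.Injective τ)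
    {β : Fin L → ℂ} (hβ : ∀ l, β l ≠ 0) (x : Param L → ℝ)
    (h : ∀ f ∈ Set.Ioo (0 : ℝ) 1, ∑ k, (x k : ℂ) * response τ β f k = 0) : x = 0 := by
  have hpi : (2 * Real.pi * Complex.I : ℂ) ≠ 0 := Complex.two_pi_I_ne_zero
  obtain ⟨hc, hd⟩ := eq_zero_of_sum_affine_mul_exp_eq_zero
    (ν := fun l => -(2 * Real.pi * Complex.I) * τ l)
    (fun a b hab => hτ (by
      have := mul_left_cancel₀ (neg_ne_zero.2 hpi) hab
      exact_mod_cast this))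
    (fun l => x (.inr (.inl l)) + x (.inr (.inr l)) * Complex.I)
    (fun l => -(2 * Real.pi * Complex.I) * β l * x (.inl l)) (fun f hf => by
      rw [← h f hf]
      simp only [Fintype.sum_sum_type, response, Sum.elim_inl, Sum.elim_inr, phase,
        ← Finset.sum_add_distrib]
      refine Finset.sum_congr rfl fun l _ => ?_
      rw [show -(2 * (Real.pi : ℂ) * Complex.I) * τ l * f = -(2 * Real.pi * Complex.I * f * τ l) by
        ring]
      ring)
  funext k
  rcases k with l | l | l
  · have := congrFun hd l
    simpa [hβ l, Real.pi_ne_zero] using this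
  · have := congrArg Complex.re (congrFun hc l)
    simpa using this
  · have := congrArg Complex.im (congrFun hc l)
    simpa using this

lemma continuous_response (k : Param L) : Continuous fun f => response τ β f k := by
  rcases k with l | l | l <;> simp only [response, phase, Sum.elim_inl, Sum.elim_inr] <;> fun_prop

lemma continuous_infoDensity (k l : Param L) : Continuous fun f => infoDensity σ τ β f k l := by
  simp only [infoDensity, Matrix.of_apply]
  have h1 := continuous_response τ β k
  have h2 := continuous_response τ β l
  fun_prop

/-- The quadratic form of the information density is a squared modulus. -/
lemma dotProduct_infoDensity_mulVec (f : ℝ) (x : Param L → ℝ) :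
    x ⬝ᵥ infoDensity σ τ β f *ᵥ x = 2 / σ ^ 2 * ‖∑ k, (x k : ℂ) * response τ β f k‖ ^ 2 := by
  have h : ((‖∑ k, (x k : ℂ) * response τ β f k‖ ^ 2 : ℝ) : ℂ)
      = ∑ k, ∑ l, ((x k * x l : ℝ) : ℂ) * (star (response τ β f k) * response τ β f l) := by
    rw [← Complex.normSq_eq_norm_sq, ← Complex.mul_conj, mul_comm, ← Complex.star_def, star_sum,
      Finset.sum_mul_sum]
    refine Finset.sum_congr rfl fun k _ => Finset.sum_congr rfl fun l _ => ?_
    rw [star_mul', Complex.star_def, Complex.conj_ofReal]; push_cast; ring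
  have h' := congrArg Complex.re h
  rw [Complex.ofReal_re] at h'
  rw [h']
  simp only [Complex.re_sum, Complex.re_ofReal_mul, dotProduct, Matrix.mulVec, infoDensity,
    Matrix.of_apply, Finset.mul_sum]
  refine Finset.sum_congr rfl fun k _ => Finset.sum_congr rfl fun l _ => ?_
  ring

lemma infoDensity_transpose (f : ℝ) : (infoDensity σ τ β f)ᵀ = infoDensity σ τ β f := by
  ext k l
  simp only [infoDensity, Matrix.transpose_apply, Matrix.of_apply]
  congr 1
  rw [← Complex.conj_re, ← Complex.star_def, star_mul', star_star, mul_comm]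

lemma infoDensity_nonneg (f : ℝ) (x : Param L → ℝ) : 0 ≤ x ⬝ᵥ infoDensity σ τ β f *ᵥ x := by
  rw [dotProduct_infoDensity_mulVec]; positivity

lemma avgInfo_transpose (N : ℕ) : (avgInfo σ τ β N)ᵀ = avgInfo σ τ β N := by
  rw [avgInfo, Matrix.transpose_sum]
  simp only [infoDensity_transpose]

lemma dotProduct_sum_mulVec {ι κ : Type*} [Fintype ι] [Fintype κ] (A : κ → Matrix ι ι ℝ)
    (x y : ι → ℝ) : x ⬝ᵥ (∑ n, A n) *ᵥ y = ∑ n, x ⬝ᵥ A n *ᵥ y := by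
  rw [Matrix.sum_mulVec, dotProduct_sum]

lemma exists_infoDensity_bound :
    ∃ C : ℝ, 0 < C ∧ ∀ f ∈ Set.Icc (0 : ℝ) 1, ∀ k l, |infoDensity σ τ β f k l| ≤ C := by
  obtain ⟨C, hC⟩ := isCompact_Icc.exists_bound_of_continuousOn (s := Set.Icc (0 : ℝ) 1)
    (f := fun f => ∑ k, ∑ l, |infoDensity σ τ β f k l|)
    (Continuous.continuousOn (by
      have := continuous_infoDensity σ τ β
      fun_prop))
  refine ⟨max C 1, by positivity, fun f hf k l => le_max_of_le_left ?_⟩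
  have h1 := hC f hf
  refine le_trans ?_ ((le_abs_self _).trans h1)
  calc |infoDensity σ τ β f k l| ≤ ∑ l, |infoDensity σ τ β f k l| :=
        Finset.single_le_sum (f := fun l => |infoDensity σ τ β f k l|)
          (fun _ _ => abs_nonneg _) (Finset.mem_univ l)
    _ ≤ _ := Finset.single_le_sum (f := fun k => ∑ l, |infoDensity σ τ β f k l|)
          (fun _ _ => Finset.sum_nonneg fun _ _ => abs_nonneg _) (Finset.mem_univ k)

lemma freq_mem_Icc {N : ℕ} (n : Fin N) : freq n ∈ Set.Icc (0 : ℝ) 1 := by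
  have hN : (0 : ℝ) < N := by exact_mod_cast n.pos
  refine ⟨by unfold freq; positivity, ?_⟩
  rw [freq, div_le_one hN]
  exact_mod_cast n.2.le

/-- Every interval around an interior frequency contains a positive fraction of the bins. -/
lemma exists_card_bins_ge {f₀ δ : ℝ} (hf₀ : 0 < f₀) (hδ : 0 < δ) (hf₁ : f₀ + δ < 1) :
    ∃ N₀ : ℕ, ∀ N ≥ N₀,
      δ / 4 * N ≤ ((Finset.univ : Finset (Fin N)).filter fun n => |freq n - f₀| < δ).card := by
  refine ⟨⌈4 / δ⌉₊ + 1, fun N hN => ?_⟩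
  have hN4 : 4 / δ < N := lt_of_le_of_lt (Nat.le_ceil _) (by exact_mod_cast hN)
  have hNδ : 4 < N * δ := by rwa [div_lt_iff₀ hδ] at hN4
  have hN0 : (0 : ℝ) < N := lt_trans (by positivity) hN4
  set n₀ := ⌊(N : ℝ) * f₀⌋₊
  set m := ⌊(N : ℝ) * δ / 2⌋₊
  have hn₀ : (n₀ : ℝ) ≤ N * f₀ := Nat.floor_le (by positivity)
  have hn₀' : N * f₀ < (n₀ : ℝ) + 1 := Nat.lt_floor_add_one _
  have hm : (m : ℝ) ≤ N * δ / 2 := Nat.floor_le (by positivity)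
  have hm' : N * δ / 2 < (m : ℝ) + 1 := Nat.lt_floor_add_one _
  have hmem : ∀ i ∈ Finset.range m, n₀ + 1 + i < N ∧ |((n₀ + 1 + i : ℕ) : ℝ) / N - f₀| < δ := by
    intro i hi
    have hi' : (i : ℝ) + 1 ≤ m := by exact_mod_cast Finset.mem_range.1 hi
    have hNf : (N : ℝ) * (f₀ + δ) < N := by nlinarith
    constructor
    · have : ((n₀ + 1 + i : ℕ) : ℝ) < N := by push_cast; nlinarith
      exact_mod_cast this
    · rw [abs_lt]
      constructor
      · have : f₀ ≤ ((n₀ + 1 + i : ℕ) : ℝ) / N := by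
          rw [le_div_iff₀ hN0]; push_cast; nlinarith [Nat.cast_nonneg (α := ℝ) i]
        linarith
      · rw [sub_lt_iff_lt_add, div_lt_iff₀ hN0]; push_cast; nlinarith
  have hcard : m ≤ ((Finset.univ : Finset (Fin N)).filter fun n => |freq n - f₀| < δ).card := by
    calc m = (Finset.range m).attach.card := by simp
      _ ≤ _ := by
        refine Finset.card_le_card_of_injOn
          (fun i => (⟨n₀ + 1 + i.1, (hmem i.1 i.2).1⟩ : Fin N)) ?_ ?_
        · intro i _
          exact Finset.mem_coe.2 (Finset.mem_filter.2 ⟨Finset.mem_univ _, (hmem i.1 i.2).2⟩)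
        · intro i _ j _ hij
          have := congrArg Fin.val hij
          exact Subtype.ext (by simpa using this)
  calc δ / 4 * N ≤ m := by nlinarith
    _ ≤ _ := by exact_mod_cast hcard

/-- The averaged Fisher information grows at least linearly with the block length, in all
directions. -/
lemma exists_avgInfo_coercive {σ : ℝ} (hσ : 0 < σ) {τ : Fin L → ℝ} (hτ : Function.Injective τ)
    {β : Fin L → ℂ} (hβ : ∀ l, β l ≠ 0) :
    ∃ ε : ℝ, 0 < ε ∧ ∃ N₀ : ℕ, ∀ N ≥ N₀, ∀ x : Param L → ℝ,
      ε * N * (x ⬝ᵥ x) ≤ x ⬝ᵥ avgInfo σ τ β N *ᵥ x := by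
  classical
  set Φ : (Param L → ℝ) × ℝ → ℝ := fun p => p.1 ⬝ᵥ infoDensity σ τ β p.2 *ᵥ p.1 with hΦ
  have hcont : Continuous Φ := by
    simp only [hΦ, dotProduct, Matrix.mulVec]
    have h (k l : Param L) : Continuous fun p : (Param L → ℝ) × ℝ => infoDensity σ τ β p.2 k l :=
      (continuous_infoDensity σ τ β k l).comp continuous_snd
    fun_prop
  have hsphere : ∃ ε : ℝ, 0 < ε ∧ ∃ N₀ : ℕ, ∀ N ≥ N₀,
      ∀ x ∈ Metric.sphere (0 : Param L → ℝ) 1, ε * N ≤ x ⬝ᵥ avgInfo σ τ β N *ᵥ x := by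
    refine (isCompact_sphere (0 : Param L → ℝ) 1).induction_on
      (p := fun K => ∃ ε : ℝ, 0 < ε ∧ ∃ N₀ : ℕ, ∀ N ≥ N₀,
        ∀ x ∈ K, ε * N ≤ x ⬝ᵥ avgInfo σ τ β N *ᵥ x) ?_ ?_ ?_ ?_
    · exact ⟨1, one_pos, 0, by simp⟩
    · rintro s t hst ⟨ε, hε, N₀, h⟩
      exact ⟨ε, hε, N₀, fun N hN x hx => h N hN x (hst hx)⟩
    · rintro s t ⟨ε, hε, N₀, h⟩ ⟨ε', hε', N₀', h'⟩
      refine ⟨min ε ε', lt_min hε hε', max N₀ N₀', fun N hN x hx => ?_⟩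
      rcases hx with hx | hx
      · exact le_trans (by gcongr; exact min_le_left _ _) (h N (le_of_max_le_left hN) x hx)
      · exact le_trans (by gcongr; exact min_le_right _ _) (h' N (le_of_max_le_right hN) x hx)
    · intro x hx
      have hx0 : x ≠ 0 := by
        rintro rfl; simp at hx
      obtain ⟨f₀, hf₀, hne⟩ : ∃ f ∈ Set.Ioo (0 : ℝ) 1, ∑ k, (x k : ℂ) * response τ β f k ≠ 0 := by
        by_contra! h
        exact hx0 (eq_zero_of_sum_response_eq_zero hτ hβ x h)
      have hpos : 0 < Φ (x, f₀) := by
        simp only [hΦ]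
        rw [dotProduct_infoDensity_mulVec]
        have := norm_pos_iff.2 hne
        positivity
      have hnear : ∀ᶠ p in nhds (x, f₀), Φ (x, f₀) / 2 < Φ p :=
        hcont.continuousAt.eventually (lt_mem_nhds (half_lt_self hpos))
      rw [nhds_prod_eq, Filter.eventually_prod_iff] at hnear
      obtain ⟨pa, ha, pb, hb, hab⟩ := hnear
      obtain ⟨δ₁, hδ₁, hball⟩ := Metric.eventually_nhds_iff.1 hb
      set δ := min δ₁ ((1 - f₀) / 2) with hδ
      have hδpos : 0 < δ := lt_min hδ₁ (by linarith [hf₀.2])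
      have hδ' : f₀ + δ < 1 := by
        have : δ ≤ (1 - f₀) / 2 := min_le_right _ _
        linarith [hf₀.2]
      obtain ⟨N₀, hN₀⟩ := exists_card_bins_ge hf₀.1 hδpos hδ'
      refine ⟨{y | pa y}, mem_nhdsWithin_of_mem_nhds ha, Φ (x, f₀) / 2 * (δ / 4), by positivity,
        N₀, fun N hN y hy => ?_⟩
      rw [avgInfo, dotProduct_sum_mulVec]
      set G := (Finset.univ : Finset (Fin N)).filter fun n => |freq n - f₀| < δ
      calc Φ (x, f₀) / 2 * (δ / 4) * N = Φ (x, f₀) / 2 * (δ / 4 * N) := by ring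
        _ ≤ Φ (x, f₀) / 2 * G.card := by gcongr; exact hN₀ N hN
        _ = ∑ n ∈ G, Φ (x, f₀) / 2 := by simp [mul_comm]
        _ ≤ ∑ n ∈ G, y ⬝ᵥ infoDensity σ τ β (freq n) *ᵥ y := by
            refine Finset.sum_le_sum fun n hn => ?_
            have hn' : |freq n - f₀| < δ := (Finset.mem_filter.1 hn).2
            exact (hab hy (hball (by
              rw [Real.dist_eq]; exact lt_of_lt_of_le hn' (min_le_left _ _)))).le
        _ ≤ ∑ n, y ⬝ᵥ infoDensity σ τ β (freq n) *ᵥ y :=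
            Finset.sum_le_sum_of_subset_of_nonneg (Finset.subset_univ _)
              fun n _ _ => infoDensity_nonneg σ τ β _ _
  obtain ⟨ε, hε, N₀, h⟩ := hsphere
  set d : ℝ := Fintype.card (Param L) + 1 with hd
  refine ⟨ε / d, by positivity, N₀, fun N hN x => ?_⟩
  rcases eq_or_ne x 0 with rfl | hx
  · simp
  have hnx : 0 < ‖x‖ := norm_pos_iff.2 hx
  have h1 := h N hN (‖x‖⁻¹ • x) (by
    rw [mem_sphere_zero_iff_norm, norm_smul, norm_inv, norm_norm, inv_mul_cancel₀ hnx.ne'])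
  rw [Matrix.mulVec_smul, dotProduct_smul, smul_dotProduct, smul_eq_mul, smul_eq_mul,
    ← mul_assoc, ← sq, inv_pow, ← div_eq_inv_mul, le_div_iff₀ (by positivity)] at h1
  have h2 : x ⬝ᵥ x ≤ d * ‖x‖ ^ 2 := by
    calc x ⬝ᵥ x ≤ ∑ _k : Param L, ‖x‖ ^ 2 := by
          refine Finset.sum_le_sum fun k _ => ?_
          rw [← sq, ← sq_abs]
          gcongr
          exact norm_le_pi_norm x k
      _ = Fintype.card (Param L) * ‖x‖ ^ 2 := by simp
      _ ≤ _ := by gcongr; simp [hd]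
  calc ε / d * N * (x ⬝ᵥ x) ≤ ε / d * N * (d * ‖x‖ ^ 2) := by gcongr
    _ = ε * N * ‖x‖ ^ 2 := by
        have : d ≠ 0 := by positivity
        field_simp
    _ ≤ _ := h1

end Coercivity

/-! ### Perturbation of the inverse of a matrix -/

section Perturbation

open scoped Matrix.Norms.L2Operator

variable {ι : Type*} [Fintype ι] [DecidableEq ι]

/-- A coercive matrix is invertible, and its inverse is bounded by the inverse of the constant. -/
lemma isUnit_and_norm_inv_le_of_coercive {J : Matrix ι ι ℝ} {c : ℝ} (hc : 0 < c)
    (h : ∀ x, c * (x ⬝ᵥ x) ≤ x ⬝ᵥ J *ᵥ x) : IsUnit J ∧ ‖J⁻¹‖ ≤ 1 / c := by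
  have hJ : IsUnit J := by
    rw [← Matrix.mulVec_injective_iff_isUnit, ← Matrix.coe_mulVecLin, ← LinearMap.ker_eq_bot]
    refine LinearMap.ker_eq_bot'.2 fun x hx => ?_
    have h1 := h x
    rw [Matrix.mulVecLin_apply] at hx
    rw [hx, dotProduct_zero] at h1
    have h2 : x ⬝ᵥ x = 0 := le_antisymm (nonpos_of_mul_nonpos_right h1 hc)
      (Finset.sum_nonneg fun i _ => mul_self_nonneg _)
    exact dotProduct_self_eq_zero.1 h2
  refine ⟨hJ, ?_⟩
  rw [← Matrix.l2_opNorm_toEuclideanCLM]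
  refine ContinuousLinearMap.opNorm_le_bound _ (by positivity) fun y => ?_
  set z := Matrix.toEuclideanCLM (n := ι) (𝕜 := ℝ) J⁻¹ y with hz
  have hJz : Matrix.toEuclideanCLM (n := ι) (𝕜 := ℝ) J z = y := by
    rw [hz, ← mul_apply_eq_comp, ← map_mul,
      Matrix.mul_nonsing_inv _ ((Matrix.isUnit_iff_isUnit_det _).1 hJ), map_one]
    rfl
  have h1 : c * ‖z‖ ^ 2 ≤ ‖z‖ * ‖y‖ := by
    calc c * ‖z‖ ^ 2 = c * (z.ofLp ⬝ᵥ z.ofLp) := by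
          rw [EuclideanSpace.real_norm_sq_eq]
          simp only [dotProduct, sq]
      _ ≤ z.ofLp ⬝ᵥ J *ᵥ z.ofLp := h _
      _ = inner ℝ z (Matrix.toEuclideanCLM (n := ι) (𝕜 := ℝ) J z) :=
          (Matrix.inner_toEuclideanCLM J z z).symm
      _ ≤ ‖z‖ * ‖y‖ := by rw [hJz]; exact real_inner_le_norm z y
  rcases (norm_nonneg z).eq_or_lt with h0 | h0
  · rw [← h0]; positivity
  · rw [one_div, ← div_eq_inv_mul, le_div_iff₀ hc]
    nlinarith

/-- A relative perturbation of size `ρ < 1` keeps a matrix invertible. -/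
lemma isUnit_and_norm_inv_le_of_relative {J₀ J : Matrix ι ι ℝ} (h₀ : IsUnit J₀) {ρ : ℝ}
    (hρ : ρ < 1) (h : ‖J₀⁻¹ * (J - J₀)‖ < ρ) :
    IsUnit J ∧ ‖J⁻¹‖ ≤ 1 / (1 - ρ) * ‖J₀⁻¹‖ := by
  have hdet := (Matrix.isUnit_iff_isUnit_det _).1 h₀
  have : CompleteSpace (Matrix ι ι ℝ) := FiniteDimensional.complete ℝ _
  set Z := J₀⁻¹ * (J - J₀) with hZ
  have hJ : J = J₀ * (1 - -Z) := by
    rw [sub_neg_eq_add, mul_add, mul_one, hZ, ← mul_assoc, Matrix.mul_nonsing_inv _ hdet, one_mul]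
    abel
  have hunit : IsUnit J := by
    rw [hJ]
    exact h₀.mul (isUnit_one_sub_of_norm_lt_one (by rw [norm_neg]; linarith))
  refine ⟨hunit, ?_⟩
  have hdetJ := (Matrix.isUnit_iff_isUnit_det _).1 hunit
  have hinv : J⁻¹ = J₀⁻¹ - Z * J⁻¹ := by
    rw [hZ, mul_assoc, sub_mul, Matrix.mul_nonsing_inv _ hdetJ, mul_sub, mul_one, ← mul_assoc,
      Matrix.nonsing_inv_mul _ hdet, one_mul]
    abel
  have h1 : ‖J⁻¹‖ ≤ ‖J₀⁻¹‖ + ρ * ‖J⁻¹‖ := by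
    calc ‖J⁻¹‖ = ‖J₀⁻¹ - Z * J⁻¹‖ := congrArg norm hinv
      _ ≤ ‖J₀⁻¹‖ + ‖Z * J⁻¹‖ := norm_sub_le _ _
      _ ≤ ‖J₀⁻¹‖ + ‖Z‖ * ‖J⁻¹‖ := by gcongr; exact norm_mul_le _ _
      _ ≤ _ := by gcongr
  rw [one_div, ← div_eq_inv_mul, le_div_iff₀ (by linarith)]
  linarith

/-- The Neumann expansion of the inverse to second order, with exact remainder. -/
lemma inv_eq_neumann {J₀ J : Matrix ι ι ℝ} (h₀ : IsUnit J₀) (hJ : IsUnit J) :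
    J⁻¹ = J₀⁻¹ - J₀⁻¹ * (J - J₀) * J₀⁻¹ + J₀⁻¹ * (J - J₀) * J₀⁻¹ * (J - J₀) * J₀⁻¹
      - J₀⁻¹ * (J - J₀) * J₀⁻¹ * (J - J₀) * J₀⁻¹ * (J - J₀) * J⁻¹ := by
  have hdet := (Matrix.isUnit_iff_isUnit_det _).1 h₀
  have hdetJ := (Matrix.isUnit_iff_isUnit_det _).1 hJ
  have hinv : J₀⁻¹ * (J - J₀) * J⁻¹ = J₀⁻¹ - J⁻¹ := by
    rw [mul_assoc, sub_mul, Matrix.mul_nonsing_inv _ hdetJ, mul_sub, mul_one, ← mul_assoc,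
      Matrix.nonsing_inv_mul _ hdet, one_mul]
  set X := J₀⁻¹ * (J - J₀) with hX
  have h2 : X * J₀⁻¹ * (J - J₀) * J₀⁻¹ = X * (X * J₀⁻¹) := by simp only [hX, mul_assoc]
  have h3 : X * J₀⁻¹ * (J - J₀) * J₀⁻¹ * (J - J₀) * J⁻¹ = X * (X * (X * J⁻¹)) := by
    simp only [hX, mul_assoc]
  rw [h3, h2, hinv]
  simp only [mul_sub, hinv]
  abel

/-- A weighted trace is bounded by the spectral norm. -/
lemma exists_abs_trace_mul_le (T : Matrix ι ι ℝ) :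
    ∃ C : ℝ, 0 < C ∧ ∀ A : Matrix ι ι ℝ, |(T * A).trace| ≤ C * ‖A‖ := by
  let φ : Matrix ι ι ℝ →ₗ[ℝ] ℝ :=
    (Matrix.traceLinearMap ι ℝ ℝ).comp (LinearMap.mulLeft ℝ T)
  refine ⟨‖LinearMap.toContinuousLinearMap φ‖ + 1, by positivity, fun A => ?_⟩
  calc |(T * A).trace| = ‖LinearMap.toContinuousLinearMap φ A‖ := rfl
    _ ≤ ‖LinearMap.toContinuousLinearMap φ‖ * ‖A‖ := ContinuousLinearMap.le_opNorm _ _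
    _ ≤ _ := by gcongr; linarith

/-- The fourth power of the spectral norm is controlled by the fourth powers of the entries. -/
lemma exists_norm_pow_four_le (ι : Type*) [Fintype ι] [DecidableEq ι] :
    ∃ C : ℝ, 0 < C ∧ ∀ A : Matrix ι ι ℝ, ‖A‖ ^ 4 ≤ C * ∑ k, ∑ l, A k l ^ 4 := by
  set K : ℝ := (∑ k : ι, ∑ l : ι, ‖Matrix.single k l (1 : ℝ)‖) + 1 with hK
  have hKpos : 0 < K := by positivity
  set n : ℝ := (Fintype.card (ι × ι) : ℝ) with hn
  refine ⟨K ^ 4 * (n ^ 3 + 1), by positivity, fun A => ?_⟩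
  have hsingle : ∀ k l : ι, ‖Matrix.single k l (1 : ℝ)‖ ≤ K := by
    intro k l
    have h1 : ‖Matrix.single k l (1 : ℝ)‖ ≤ ∑ l : ι, ‖Matrix.single k l (1 : ℝ)‖ :=
      Finset.single_le_sum (f := fun l => ‖Matrix.single k l (1 : ℝ)‖)
        (fun _ _ => norm_nonneg _) (Finset.mem_univ l)
    have h2 : ∑ l : ι, ‖Matrix.single k l (1 : ℝ)‖
        ≤ ∑ k : ι, ∑ l : ι, ‖Matrix.single k l (1 : ℝ)‖ :=
      Finset.single_le_sum (f := fun k => ∑ l : ι, ‖Matrix.single k l (1 : ℝ)‖)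
        (fun _ _ => Finset.sum_nonneg fun _ _ => norm_nonneg _) (Finset.mem_univ k)
    linarith
  have h1 : ‖A‖ ≤ K * ∑ p : ι × ι, |A p.1 p.2| := by
    conv_lhs => rw [Matrix.matrix_eq_sum_single A]
    rw [Fintype.sum_prod_type, Finset.mul_sum]
    refine (norm_sum_le _ _).trans (Finset.sum_le_sum fun k _ => ?_)
    rw [Finset.mul_sum]
    refine (norm_sum_le _ _).trans (Finset.sum_le_sum fun l _ => ?_)
    rw [show Matrix.single k l (A k l) = A k l • Matrix.single k l (1 : ℝ) by
      rw [Matrix.smul_single, smul_eq_mul, mul_one], norm_smul, mul_comm, Real.norm_eq_abs]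
    gcongr
    exact hsingle k l
  have h2 : (∑ p : ι × ι, |A p.1 p.2|) ^ 4 ≤ (n ^ 3 + 1) * ∑ p : ι × ι, A p.1 p.2 ^ 4 := by
    have h3 : (∑ p : ι × ι, |A p.1 p.2|) ^ 2 ≤ n * ∑ p : ι × ι, |A p.1 p.2| ^ 2 :=
      sq_sum_le_card_mul_sum_sq
    have h4 : (∑ p : ι × ι, A p.1 p.2 ^ 2) ^ 2 ≤ n * ∑ p : ι × ι, (A p.1 p.2 ^ 2) ^ 2 :=
      sq_sum_le_card_mul_sum_sq
    simp only [sq_abs, ← pow_mul] at h3 h4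
    have hn0 : 0 ≤ n := by positivity
    calc (∑ p : ι × ι, |A p.1 p.2|) ^ 4 = ((∑ p : ι × ι, |A p.1 p.2|) ^ 2) ^ 2 := by ring
      _ ≤ (n * ∑ p : ι × ι, A p.1 p.2 ^ 2) ^ 2 := by gcongr
      _ = n ^ 2 * (∑ p : ι × ι, A p.1 p.2 ^ 2) ^ 2 := by ring
      _ ≤ n ^ 2 * (n * ∑ p : ι × ι, A p.1 p.2 ^ 4) := by gcongr
      _ = n ^ 3 * ∑ p : ι × ι, A p.1 p.2 ^ 4 := by ring
      _ ≤ _ := by gcongr; linarith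
  calc ‖A‖ ^ 4 ≤ (K * ∑ p : ι × ι, |A p.1 p.2|) ^ 4 := by gcongr
    _ = K ^ 4 * (∑ p : ι × ι, |A p.1 p.2|) ^ 4 := by ring
    _ ≤ K ^ 4 * ((n ^ 3 + 1) * ∑ p : ι × ι, A p.1 p.2 ^ 4) := by gcongr
    _ = _ := by rw [Fintype.sum_prod_type]; ring

end Perturbation

/-! ### Conditional expectations of perturbation expansions -/

/-- Conditioning on an event whose complement has probability `O(q⁻⁴)` changes the average of a
second-order expansion `f = f₀ - f₁ + f₂ + O(y³ q⁻⁵)` with `f₁` centred, `f₁ = O(y q⁻³)` and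
`f₂ = O(y² q⁻⁴)`, by `O(q⁻⁵)` only, if `y` has a bounded fourth moment. -/
lemma abs_expect_sub_le_of_expansion {Ω : Type*} [DecidableEq Ω] {P A : Finset Ω} (hAP : A ⊆ P)
    {f f₁ f₂ y : Ω → ℝ} {f₀ q C K : ℝ} (hq : 1 ≤ q) (hC : 0 ≤ C) (hK : 0 ≤ K)
    (hy4 : 𝔼 s ∈ P, y s ^ 4 ≤ K) (hcent : 𝔼 s ∈ P, f₁ s = 0)
    (hf₁ : ∀ s ∈ P, |f₁ s| ≤ C / q ^ 3 * y s) (hf₂ : ∀ s ∈ P, |f₂ s| ≤ C / q ^ 4 * y s ^ 2)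
    (hf : ∀ s ∈ A, |f s - (f₀ - f₁ s + f₂ s)| ≤ C / q ^ 5 * y s ^ 3)
    (hcompl : ((P \ A).card : ℝ) ≤ K / q ^ 4 * P.card) (hhalf : (P.card : ℝ) ≤ 2 * A.card)
    (hA : A.Nonempty) :
    |𝔼 s ∈ A, f s - f₀ - 𝔼 s ∈ P, f₂ s| ≤ 2 * C * (2 + 6 * K + K ^ 2) / q ^ 5 := by
  have hq0 : 0 < q := by linarith
  have hP : P.Nonempty := hA.mono hAP
  set p : ℝ := (P.card : ℝ) with hp
  set a : ℝ := (A.card : ℝ) with ha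
  set b : ℝ := ((P \ A).card : ℝ) with hb
  have hp0 : 0 < p := by rw [hp]; exact_mod_cast hP.card_pos
  have ha0 : 0 < a := by rw [ha]; exact_mod_cast hA.card_pos
  have hb0 : 0 ≤ b := by positivity
  have hpab : p = a + b := by
    rw [hp, ha, hb, ← Nat.cast_add, add_comm, Finset.card_sdiff_add_card_eq_card hAP]
  set B := P \ A with hB
  have hBP : B ⊆ P := Finset.sdiff_subset
  have hsplit : ∀ g : Ω → ℝ, ∑ s ∈ A, g s + ∑ s ∈ B, g s = ∑ s ∈ P, g s := fun g => by
    rw [add_comm]; exact Finset.sum_sdiff hAP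
  have hsum4 : ∑ s ∈ P, y s ^ 4 ≤ p * K := by
    rw [Finset.expect_eq_sum_div_card, div_le_iff₀ hp0] at hy4; linarith
  have hsub4 : ∀ D ⊆ P, ∑ s ∈ D, y s ^ 4 ≤ p * K := fun D hD =>
    (Finset.sum_le_sum_of_subset_of_nonneg hD fun _ _ _ => by positivity).trans hsum4
  have hq2 : 1 ≤ q ^ 2 := one_le_pow₀ hq
  -- averages of powers of `y` over the rare event, over `A` and over everything
  have hfour : ∀ s, y s ^ 2 ≤ 1 + y s ^ 4 := fun s => by nlinarith [sq_nonneg (y s ^ 2 - 1)]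
  have hrare1 : ∑ s ∈ B, y s ≤ p * (1 + 2 * K) / q ^ 2 := by
    have hpt : ∀ s, y s ≤ (1 + y s ^ 4) / q ^ 2 + q ^ 2 := by
      intro s
      have h1 : y s ≤ y s ^ 2 / q ^ 2 + q ^ 2 := by
        rw [div_add' _ _ _ (by positivity), le_div_iff₀ (by positivity)]
        nlinarith [sq_nonneg (y s - q ^ 2), sq_nonneg (y s), sq_nonneg (y s + q ^ 2)]
      exact h1.trans (by gcongr; exact hfour s)
    calc ∑ s ∈ B, y s ≤ ∑ s ∈ B, ((1 + y s ^ 4) / q ^ 2 + q ^ 2) :=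
          Finset.sum_le_sum fun s _ => hpt s
      _ = (b + ∑ s ∈ B, y s ^ 4) / q ^ 2 + b * q ^ 2 := by
          rw [Finset.sum_add_distrib, ← Finset.sum_div, Finset.sum_add_distrib]
          simp [hb]
      _ ≤ (p + p * K) / q ^ 2 + (K / q ^ 4 * p) * q ^ 2 := by
          gcongr
          · linarith
          · exact hsub4 B hBP
      _ = p * (1 + 2 * K) / q ^ 2 := by field_simp; ring
  have hrare2 : ∑ s ∈ B, y s ^ 2 ≤ 2 * p * K / q ^ 2 := by
    have hpt : ∀ s, y s ^ 2 ≤ y s ^ 4 / q ^ 2 + q ^ 2 := by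
      intro s
      rw [div_add' _ _ _ (by positivity), le_div_iff₀ (by positivity)]
      nlinarith [sq_nonneg (y s ^ 2 - q ^ 2), sq_nonneg (y s ^ 2 + q ^ 2), sq_nonneg (y s ^ 2)]
    calc ∑ s ∈ B, y s ^ 2 ≤ ∑ s ∈ B, (y s ^ 4 / q ^ 2 + q ^ 2) :=
          Finset.sum_le_sum fun s _ => hpt s
      _ = (∑ s ∈ B, y s ^ 4) / q ^ 2 + b * q ^ 2 := by
          rw [Finset.sum_add_distrib, ← Finset.sum_div]
          simp [hb]
      _ ≤ (p * K) / q ^ 2 + (K / q ^ 4 * p) * q ^ 2 := by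
          gcongr
          exact hsub4 B hBP
      _ = 2 * p * K / q ^ 2 := by field_simp; ring
  have hall2 : ∑ s ∈ P, y s ^ 2 ≤ p * (1 + K) := by
    calc ∑ s ∈ P, y s ^ 2 ≤ ∑ s ∈ P, (1 + y s ^ 4) := Finset.sum_le_sum fun s _ => hfour s
      _ = p + ∑ s ∈ P, y s ^ 4 := by rw [Finset.sum_add_distrib]; simp [hp]
      _ ≤ _ := by linarith
  have hall3 : ∑ s ∈ A, y s ^ 3 ≤ p * (1 + K) := by
    calc ∑ s ∈ A, y s ^ 3 ≤ ∑ s ∈ A, (1 + y s ^ 4) := by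
          refine Finset.sum_le_sum fun s _ => ?_
          nlinarith [sq_nonneg (y s ^ 2 - y s), sq_nonneg (y s - 1), sq_nonneg (y s ^ 2 - 1)]
      _ = a + ∑ s ∈ A, y s ^ 4 := by rw [Finset.sum_add_distrib]; simp [ha]
      _ ≤ _ := by linarith [hsub4 A hAP]
  -- the four error terms
  have e1 : |∑ s ∈ A, f₁ s| ≤ C * p * (1 + 2 * K) / q ^ 5 := by
    have h0 : ∑ s ∈ P, f₁ s = 0 := by
      rw [Finset.expect_eq_sum_div_card, div_eq_zero_iff] at hcent
      exact hcent.resolve_right hp0.ne'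
    have h1 : ∑ s ∈ A, f₁ s = -∑ s ∈ B, f₁ s := by linarith [hsplit f₁]
    rw [h1, abs_neg]
    calc |∑ s ∈ B, f₁ s| ≤ ∑ s ∈ B, C / q ^ 3 * y s :=
          (Finset.abs_sum_le_sum_abs _ _).trans
            (Finset.sum_le_sum fun s hs => hf₁ s (hBP hs))
      _ = C / q ^ 3 * ∑ s ∈ B, y s := by rw [Finset.mul_sum]
      _ ≤ C / q ^ 3 * (p * (1 + 2 * K) / q ^ 2) := by gcongr
      _ = _ := by field_simp
  set m := 𝔼 s ∈ P, f₂ s with hm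
  have hpm : ∑ s ∈ P, f₂ s = p * m := by
    rw [hm, Finset.expect_eq_sum_div_card, ← hp]; field_simp
  have hq45 : 1 / q ^ 8 ≤ 1 / q ^ 5 := by
    gcongr
    norm_num
  have hq65 : 1 / q ^ 6 ≤ 1 / q ^ 5 := by
    gcongr
    norm_num
  have e2 : |b * m| ≤ C * p * (K * (1 + K)) / q ^ 5 := by
    have h1 : |m| ≤ C / q ^ 4 * (1 + K) := by
      have h2 : |p * m| ≤ C / q ^ 4 * (p * (1 + K)) := by
        rw [← hpm]
        calc |∑ s ∈ P, f₂ s| ≤ ∑ s ∈ P, C / q ^ 4 * y s ^ 2 :=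
              (Finset.abs_sum_le_sum_abs _ _).trans (Finset.sum_le_sum hf₂)
          _ = C / q ^ 4 * ∑ s ∈ P, y s ^ 2 := by rw [Finset.mul_sum]
          _ ≤ _ := by gcongr
      rw [abs_mul, abs_of_pos hp0] at h2
      refine le_of_mul_le_mul_left (h2.trans (le_of_eq ?_)) hp0
      ring
    rw [abs_mul, abs_of_nonneg hb0]
    calc b * |m| ≤ (K / q ^ 4 * p) * (C / q ^ 4 * (1 + K)) := by gcongr
      _ = C * p * (K * (1 + K)) * (1 / q ^ 8) := by field_simp
      _ ≤ C * p * (K * (1 + K)) * (1 / q ^ 5) := by gcongr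
      _ = _ := by ring
  have e3 : |∑ s ∈ B, f₂ s| ≤ C * p * (2 * K) / q ^ 5 := by
    calc |∑ s ∈ B, f₂ s| ≤ ∑ s ∈ B, C / q ^ 4 * y s ^ 2 :=
          (Finset.abs_sum_le_sum_abs _ _).trans
            (Finset.sum_le_sum fun s hs => hf₂ s (hBP hs))
      _ = C / q ^ 4 * ∑ s ∈ B, y s ^ 2 := by rw [Finset.mul_sum]
      _ ≤ C / q ^ 4 * (2 * p * K / q ^ 2) := by gcongr
      _ = C * p * (2 * K) * (1 / q ^ 6) := by field_simp
      _ ≤ C * p * (2 * K) * (1 / q ^ 5) := by gcongr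
      _ = _ := by ring
  have e4 : |∑ s ∈ A, (f s - (f₀ - f₁ s + f₂ s))| ≤ C * p * (1 + K) / q ^ 5 := by
    calc |∑ s ∈ A, (f s - (f₀ - f₁ s + f₂ s))| ≤ ∑ s ∈ A, C / q ^ 5 * y s ^ 3 :=
          (Finset.abs_sum_le_sum_abs _ _).trans (Finset.sum_le_sum hf)
      _ = C / q ^ 5 * ∑ s ∈ A, y s ^ 3 := by rw [Finset.mul_sum]
      _ ≤ C / q ^ 5 * (p * (1 + K)) := by gcongr
      _ = _ := by ring
  have hdecomp : a * (𝔼 s ∈ A, f s - f₀ - m) = -∑ s ∈ A, f₁ s + b * m - ∑ s ∈ B, f₂ s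
      + ∑ s ∈ A, (f s - (f₀ - f₁ s + f₂ s)) := by
    have h1 : a * 𝔼 s ∈ A, f s = ∑ s ∈ A, f s := Finset.card_mul_expect A f
    have h2 : ∑ s ∈ A, (f s - (f₀ - f₁ s + f₂ s))
        = ∑ s ∈ A, f s - (a * f₀ - ∑ s ∈ A, f₁ s + ∑ s ∈ A, f₂ s) := by
      simp only [Finset.sum_sub_distrib, Finset.sum_add_distrib]
      simp [ha]
    have h3 := hsplit f₂
    rw [h2, mul_sub, mul_sub, h1]
    rw [hpm, hpab] at h3
    linarith
  have htotal : a * |𝔼 s ∈ A, f s - f₀ - m| ≤ C * p * (2 + 6 * K + K ^ 2) / q ^ 5 := by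
    rw [show a * |𝔼 s ∈ A, f s - f₀ - m| = |a * (𝔼 s ∈ A, f s - f₀ - m)| by
      rw [abs_mul, abs_of_pos ha0], hdecomp]
    have h1 := abs_add_le (-∑ s ∈ A, f₁ s + b * m - ∑ s ∈ B, f₂ s)
      (∑ s ∈ A, (f s - (f₀ - f₁ s + f₂ s)))
    have h2 := abs_sub (-∑ s ∈ A, f₁ s + b * m) (∑ s ∈ B, f₂ s)
    have h3 := abs_add_le (-∑ s ∈ A, f₁ s) (b * m)
    rw [abs_neg] at h3
    have h4 : C * p * (2 + 6 * K + K ^ 2) / q ^ 5 = C * p * (1 + 2 * K) / q ^ 5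
        + C * p * (K * (1 + K)) / q ^ 5 + C * p * (2 * K) / q ^ 5 + C * p * (1 + K) / q ^ 5 := by
      ring
    linarith
  refine le_of_mul_le_mul_left (htotal.trans ?_) ha0
  calc C * p * (2 + 6 * K + K ^ 2) / q ^ 5 ≤ C * (2 * a) * (2 + 6 * K + K ^ 2) / q ^ 5 := by
        gcongr
    _ = _ := by ring

/-! ### The second-order term of the amplitude bound -/

/-- A covariance-type double sum against the doubly stochastic `W` is an average of variances
over the columns of `W`. -/
lemma sum_one_sub_gram_mul {ι : Type*} [Fintype ι] [DecidableEq ι] (W t : ι → ι → ℝ)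
    (hrow : ∀ n, ∑ i, W n i = 1) (hcol : ∀ i, ∑ n, W n i = 1) :
    ∑ n, ∑ m, ((if n = m then 1 else 0) - ∑ i, W n i * W m i) * t n m =
      1 / 2 * ∑ i, ∑ n, ∑ m, W n i * W m i * (t n n - t n m - t m n + t m m) := by
  have h1 : ∑ i, ∑ n, ∑ m, W n i * W m i * t n n = ∑ n, t n n := by
    calc ∑ i, ∑ n, ∑ m, W n i * W m i * t n n = ∑ i, ∑ n, W n i * t n n := by
          refine Finset.sum_congr rfl fun i _ => Finset.sum_congr rfl fun n _ => ?_
          rw [← Finset.sum_mul, ← Finset.mul_sum, hcol, mul_one]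
      _ = ∑ n, t n n := by
          rw [Finset.sum_comm]
          refine Finset.sum_congr rfl fun n _ => ?_
          rw [← Finset.sum_mul, hrow, one_mul]
  have h2 : ∑ i, ∑ n, ∑ m, W n i * W m i * t m m = ∑ n, t n n := by
    rw [← h1]
    refine Finset.sum_congr rfl fun i _ => ?_
    rw [Finset.sum_comm]
    refine Finset.sum_congr rfl fun n _ => Finset.sum_congr rfl fun m _ => ?_
    ring
  have h3 : ∑ i, ∑ n, ∑ m, W n i * W m i * t m n = ∑ i, ∑ n, ∑ m, W n i * W m i * t n m := by
    refine Finset.sum_congr rfl fun i _ => ?_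
    rw [Finset.sum_comm]
    refine Finset.sum_congr rfl fun n _ => Finset.sum_congr rfl fun m _ => ?_
    ring
  have h4 : ∑ n, ∑ m, (∑ i, W n i * W m i) * t n m = ∑ i, ∑ n, ∑ m, W n i * W m i * t n m := by
    simp only [Finset.sum_mul]
    symm
    rw [Finset.sum_comm]
    exact Finset.sum_congr rfl fun n _ => Finset.sum_comm
  have h5 : ∑ n, ∑ m, (if n = m then 1 else 0) * t n m = ∑ n, t n n := by
    simp
  simp only [sub_mul, mul_add, mul_sub, Finset.sum_sub_distrib, Finset.sum_add_distrib, h1, h2,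
    h3, h4, h5]
  ring

/-- Second moments about any point dominate the variance. -/
lemma sum_sq_sub_centroid_le {ι : Type*} [Fintype ι] (p f : ι → ℝ) (hp : ∑ m, p m = 1) (a : ℝ) :
    ∑ m, (f m - ∑ k, f k * p k) ^ 2 * p m ≤ ∑ m, p m * (a - f m) ^ 2 := by
  set c := ∑ k, f k * p k with hc
  have h : ∑ m, p m * (a - f m) ^ 2 = ∑ m, (f m - c) ^ 2 * p m + (a - c) ^ 2 := by
    have e : ∀ m, p m * (a - f m) ^ 2
        = (f m - c) ^ 2 * p m + ((a - c) ^ 2 + 2 * c * (a - c)) * p m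
          - 2 * (a - c) * (f m * p m) := fun m => by ring
    simp only [e, Finset.sum_add_distrib, Finset.sum_sub_distrib, ← Finset.mul_sum, hp, ← hc]
    ring
  rw [h]
  nlinarith [sq_nonneg (a - c)]

lemma trace_ampSelection_mul {L : ℕ} (A : Matrix (Param L) (Param L) ℝ) :
    (((ampSelection L)ᵀ * ampSelection L) * A).trace = ∑ k, A (.inr k) (.inr k) := by
  have h : (ampSelection L)ᵀ * ampSelection L
      = Matrix.fromBlocks 0 0 0 (1 : Matrix (Fin L ⊕ Fin L) (Fin L ⊕ Fin L) ℝ) := by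
    rw [ampSelection, Matrix.transpose_fromCols, Matrix.fromRows_mul_fromCols]
    simp
  rw [h]
  simp [Matrix.trace, Fintype.sum_sum_type, Matrix.mul_apply, Matrix.fromBlocks, Matrix.one_apply]

/-- Cauchy–Schwarz for a positive semidefinite matrix and its inverse. -/
lemma dotProduct_sq_le_mul_inv {ι : Type*} [Fintype ι] [DecidableEq ι] {J : Matrix ι ι ℝ}
    (hunit : IsUnit J) (hsymm : Jᵀ = J) (hnonneg : ∀ x, 0 ≤ x ⬝ᵥ J *ᵥ x) (w y : ι → ℝ) :
    (w ⬝ᵥ y) ^ 2 ≤ (w ⬝ᵥ J *ᵥ w) * (y ⬝ᵥ J⁻¹ *ᵥ y) := by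
  have hdet := (Matrix.isUnit_iff_isUnit_det _).1 hunit
  have hCS := LinearMap.BilinForm.apply_sq_le_of_symm (Matrix.toBilin' J)
    (fun x => by rw [Matrix.toBilin'_apply']; exact hnonneg x)
    (by
      constructor
      intro x y
      simp only [RingHom.id_apply, Matrix.toBilin'_apply']
      rw [Matrix.dotProduct_mulVec, ← Matrix.mulVec_transpose, hsymm, dotProduct_comm])
    w (J⁻¹ *ᵥ y)
  simp only [Matrix.toBilin'_apply', Matrix.mulVec_mulVec, Matrix.mul_nonsing_inv _ hdet,
    Matrix.one_mulVec] at hCS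
  rwa [dotProduct_comm (J⁻¹ *ᵥ y) y] at hCS

section SecondOrder

variable {L : ℕ} (σ : ℝ) (τ : Fin L → ℝ) (β : Fin L → ℂ)

/-- The bilinear form `Tr(T H X H Y H)`, `H = E[J]⁻¹`, whose diagonal is the second-order change of
the amplitude bound under a perturbation of `E[J]`. -/
def crbForm (N : ℕ) (X Y : Matrix (Param L) (Param L) ℝ) : ℝ :=
  (((ampSelection L)ᵀ * ampSelection L) *
    ((avgInfo σ τ β N)⁻¹ * X * (avgInfo σ τ β N)⁻¹ * Y * (avgInfo σ τ β N)⁻¹)).trace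

lemma crbForm_sub_sub (N : ℕ) (X Y : Matrix (Param L) (Param L) ℝ) :
    crbForm σ τ β N (X - Y) (X - Y) = crbForm σ τ β N X X - crbForm σ τ β N X Y
      - crbForm σ τ β N Y X + crbForm σ τ β N Y Y := by
  simp only [crbForm, mul_sub, sub_mul, Matrix.trace_sub]
  ring

lemma crbForm_sum_smul (N : ℕ) {ι : Type*} (s : Finset ι) (δ : ι → ℝ)
    (M : ι → Matrix (Param L) (Param L) ℝ) :
    crbForm σ τ β N (∑ n ∈ s, δ n • M n) (∑ n ∈ s, δ n • M n) =
      ∑ n ∈ s, ∑ m ∈ s, δ n * δ m * crbForm σ τ β N (M n) (M m) := by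
  simp only [crbForm, Finset.mul_sum, Finset.sum_mul, Matrix.trace_sum, Matrix.mul_smul,
    Matrix.smul_mul, Matrix.trace_smul, smul_eq_mul]
  rw [Finset.sum_comm]
  refine Finset.sum_congr rfl fun n _ => Finset.sum_congr rfl fun m _ => ?_
  ring

lemma avgInfo_nonneg (N : ℕ) (x : Param L → ℝ) : 0 ≤ x ⬝ᵥ avgInfo σ τ β N *ᵥ x := by
  rw [avgInfo, dotProduct_sum_mulVec]
  exact Finset.sum_nonneg fun n _ => infoDensity_nonneg σ τ β _ x

/-- On symmetric matrices `X`, the second-order form is the sum of the squared `H`-norms of the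
amplitude columns of `X H`. -/
lemma crbForm_self_eq_sum (N : ℕ) {X : Matrix (Param L) (Param L) ℝ} (hX : Xᵀ = X) :
    crbForm σ τ β N X X = ∑ k, (X * (avgInfo σ τ β N)⁻¹).col (.inr k) ⬝ᵥ
      (avgInfo σ τ β N)⁻¹ *ᵥ (X * (avgInfo σ τ β N)⁻¹).col (.inr k) := by
  rw [crbForm, trace_ampSelection_mul]
  refine Finset.sum_congr rfl fun k _ => ?_
  set J := avgInfo σ τ β N with hJ
  have h1 : J⁻¹ * X * J⁻¹ * X * J⁻¹ = (X * J⁻¹)ᵀ * (J⁻¹ * (X * J⁻¹)) := by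
    rw [Matrix.transpose_mul, Matrix.transpose_nonsing_inv, hJ, avgInfo_transpose, hX]
    simp only [mul_assoc]
  rw [h1]
  rfl

lemma crbForm_self_nonneg {N : ℕ} (hunit : IsUnit (avgInfo σ τ β N))
    {X : Matrix (Param L) (Param L) ℝ} (hX : Xᵀ = X) : 0 ≤ crbForm σ τ β N X X := by
  rw [crbForm_self_eq_sum σ τ β N hX]
  refine Finset.sum_nonneg fun k _ => ?_
  set y := (X * (avgInfo σ τ β N)⁻¹).col (.inr k)
  have h := avgInfo_nonneg σ τ β N ((avgInfo σ τ β N)⁻¹ *ᵥ y)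
  rwa [Matrix.mulVec_mulVec, Matrix.mul_nonsing_inv _
    ((Matrix.isUnit_iff_isUnit_det _).1 hunit), Matrix.one_mulVec, dotProduct_comm] at h

/-- A linear functional of `X H T_βᵀ` bounds the second-order form from below. -/
lemma sq_le_crbForm {N : ℕ} (hunit : IsUnit (avgInfo σ τ β N)) {X : Matrix (Param L) (Param L) ℝ}
    (hX : Xᵀ = X) (w : Param L → ℝ) (v : Fin L ⊕ Fin L → ℝ) :
    (w ⬝ᵥ (X * (avgInfo σ τ β N)⁻¹) *ᵥ Sum.elim 0 v) ^ 2 ≤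
      (v ⬝ᵥ v) * (w ⬝ᵥ avgInfo σ τ β N *ᵥ w) * crbForm σ τ β N X X := by
  set J := avgInfo σ τ β N with hJ
  have hsymm : Jᵀ = J := avgInfo_transpose σ τ β N
  set y : Fin L ⊕ Fin L → Param L → ℝ := fun k => (X * J⁻¹).col (.inr k) with hy
  have hform : crbForm σ τ β N X X = ∑ k, y k ⬝ᵥ J⁻¹ *ᵥ y k := crbForm_self_eq_sum σ τ β N hX
  have hw : w ⬝ᵥ (X * J⁻¹) *ᵥ Sum.elim 0 v = ∑ k, v k * (w ⬝ᵥ y k) := by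
    have h1 : (X * J⁻¹) *ᵥ Sum.elim 0 v = ∑ k, v k • y k := by
      rw [Matrix.mulVec_eq_sum, Fintype.sum_sum_type]
      simp only [Sum.elim_inl, Sum.elim_inr, Pi.zero_apply, MulOpposite.op_zero, zero_smul,
        Finset.sum_const_zero, zero_add, op_smul_eq_smul]
      rfl
    rw [h1, dotProduct_sum]
    simp only [dotProduct_smul, smul_eq_mul]
  rw [hw, hform]
  calc (∑ k, v k * (w ⬝ᵥ y k)) ^ 2 ≤ (∑ k, v k ^ 2) * ∑ k, (w ⬝ᵥ y k) ^ 2 :=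
        Finset.sum_mul_sq_le_sq_mul_sq _ _ _
    _ ≤ (v ⬝ᵥ v) * ∑ k, (w ⬝ᵥ J *ᵥ w) * (y k ⬝ᵥ J⁻¹ *ᵥ y k) := by
        have : ∑ k, v k ^ 2 = v ⬝ᵥ v := by simp only [dotProduct, sq]
        rw [this]
        refine mul_le_mul_of_nonneg_left (Finset.sum_le_sum fun k _ =>
          dotProduct_sq_le_mul_inv hunit hsymm (avgInfo_nonneg σ τ β N) w (y k)) ?_
        exact Finset.sum_nonneg fun k _ => mul_self_nonneg _
    _ = _ := by rw [← Finset.mul_sum, mul_assoc]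

lemma exists_avgInfo_le (w : Param L → ℝ) :
    ∃ C : ℝ, 0 < C ∧ ∀ N : ℕ, w ⬝ᵥ avgInfo σ τ β N *ᵥ w ≤ C * N := by
  obtain ⟨C, hC, h⟩ := exists_infoDensity_bound σ τ β
  refine ⟨C * (∑ k, |w k|) ^ 2 + 1, by positivity, fun N => ?_⟩
  have h1 : ∀ n : Fin N, w ⬝ᵥ infoDensity σ τ β (freq n) *ᵥ w ≤ C * (∑ k, |w k|) ^ 2 + 1 := by
    intro n
    calc w ⬝ᵥ infoDensity σ τ β (freq n) *ᵥ w
        = ∑ k, ∑ l, w k * (infoDensity σ τ β (freq n) k l * w l) := by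
          simp only [dotProduct, Matrix.mulVec, Finset.mul_sum]
      _ ≤ ∑ k, ∑ l, |w k| * (C * |w l|) := by
          refine Finset.sum_le_sum fun k _ => Finset.sum_le_sum fun l _ => ?_
          refine (le_abs_self _).trans ?_
          rw [abs_mul, abs_mul]
          gcongr
          exact h _ (freq_mem_Icc n) k l
      _ = C * (∑ k, |w k|) ^ 2 := by
          rw [sq, Finset.sum_mul_sum, Finset.mul_sum]
          refine Finset.sum_congr rfl fun k _ => ?_
          rw [Finset.mul_sum]
          exact Finset.sum_congr rfl fun l _ => by ring
      _ ≤ _ := by linarith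
  rw [avgInfo, dotProduct_sum_mulVec]
  calc ∑ n : Fin N, w ⬝ᵥ infoDensity σ τ β (freq n) *ᵥ w
      ≤ ∑ _n : Fin N, (C * (∑ k, |w k|) ^ 2 + 1) := Finset.sum_le_sum fun n _ => h1 n
    _ = _ := by
        rw [Finset.sum_const, Finset.card_univ, Fintype.card_fin, nsmul_eq_mul, mul_comm]

/-- The amplitude direction `i β_l` of the target `l`. Rotating the phase of `β_l` and delaying
the target act on the echo in the same way, up to a factor proportional to the frequency. -/
def phaseDirection (l : Fin L) : Fin L ⊕ Fin L → ℝ :=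
  Sum.elim (Pi.single l (-(β l).im)) (Pi.single l (β l).re)

lemma phaseDirection_dotProduct_self (l : Fin L) :
    phaseDirection β l ⬝ᵥ phaseDirection β l = ‖β l‖ ^ 2 := by
  rw [← Complex.normSq_eq_norm_sq, Complex.normSq_apply]
  simp [phaseDirection, dotProduct, Fintype.sum_sum_type, Pi.single_apply]
  ring

/-- The delay row of the information density is `-2π f` times its row along the phase direction. -/
lemma delay_row_eq (f : ℝ) (l : Fin L) (z : Param L → ℝ) :
    Pi.single (Sum.inl l) 1 ⬝ᵥ infoDensity σ τ β f *ᵥ z =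
      -(2 * Real.pi * f) * (Sum.elim 0 (phaseDirection β l) ⬝ᵥ infoDensity σ τ β f *ᵥ z) := by
  have hrow : ∀ k, infoDensity σ τ β f (.inl l) k = -(2 * Real.pi * f) *
      (-(β l).im * infoDensity σ τ β f (.inr (.inl l)) k
        + (β l).re * infoDensity σ τ β f (.inr (.inr l)) k) := by
    intro k
    simp only [infoDensity, Matrix.of_apply, response, Sum.elim_inl, Sum.elim_inr]
    set e := phase (τ l) f
    set g : ℂ := Sum.elim _ _ k
    simp only [Complex.star_def, map_mul, map_neg, Complex.conj_I, Complex.conj_ofReal,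
      Complex.mul_re, Complex.mul_im, Complex.neg_re, Complex.neg_im, Complex.I_re, Complex.I_im,
      Complex.ofReal_re, Complex.ofReal_im, Complex.conj_re, Complex.conj_im, map_ofNat,
      Complex.re_ofNat, Complex.im_ofNat]
    ring
  have hz : ∀ k, (infoDensity σ τ β f *ᵥ z) k = ∑ j, infoDensity σ τ β f k j * z j := fun _ => rfl
  have hR : Sum.elim 0 (phaseDirection β l) ⬝ᵥ infoDensity σ τ β f *ᵥ z
      = -(β l).im * (infoDensity σ τ β f *ᵥ z) (.inr (.inl l))
        + (β l).re * (infoDensity σ τ β f *ᵥ z) (.inr (.inr l)) := by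
    simp [dotProduct, Fintype.sum_sum_type, phaseDirection, Pi.single_apply]
  rw [hR, single_one_dotProduct, hz, hz, hz, Finset.mul_sum, Finset.mul_sum,
    ← Finset.sum_add_distrib, Finset.mul_sum]
  refine Finset.sum_congr rfl fun j _ => ?_
  rw [hrow]; ring

variable {σ τ β} in
/-- The second-order gap: the covariance defect of a frequency-spread waveform, paired with the
second-order form of the amplitude bound, is at least of order `N⁻²`. -/
lemma exists_secondOrder_gap (hσ : 0 < σ) (hL : 0 < L) (hτ : Function.Injective τ)
    (hβ : ∀ l, β l ≠ 0) {α : ℝ} (hα : 0 < α) :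
    ∃ c : ℝ, 0 < c ∧ ∃ N₀ : ℕ, ∀ N ≥ N₀, ∀ U : Matrix (Fin N) (Fin N) ℂ,
      IsFrequencySpread α U →
      c / (N : ℝ) ^ 2 ≤ ∑ n, ∑ m, ((if n = m then 1 else 0)
          - ∑ i, ‖(dftMatrix N * U) n i‖ ^ 2 * ‖(dftMatrix N * U) m i‖ ^ 2) *
        crbForm σ τ β N (infoDensity σ τ β (freq n)) (infoDensity σ τ β (freq m)) := by
  set l₀ : Fin L := ⟨0, hL⟩
  set v := phaseDirection β l₀ with hv
  set w₂ : Param L → ℝ := Sum.elim 0 v with hw₂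
  set w₁ : Param L → ℝ := Pi.single (Sum.inl l₀) 1 with hw₁
  set b : ℝ := ‖β l₀‖ ^ 2 with hb
  have hb0 : 0 < b := by have := norm_pos_iff.2 (hβ l₀); positivity
  have hvv : v ⬝ᵥ v = b := phaseDirection_dotProduct_self β l₀
  obtain ⟨C₁, hC₁, hJ₁⟩ := exists_avgInfo_le σ τ β w₁
  obtain ⟨C₂, hC₂, hJ₂⟩ := exists_avgInfo_le σ τ β w₂
  obtain ⟨ε, hε, N₀, hcoer⟩ := exists_avgInfo_coercive hσ hτ hβ
  refine ⟨α ^ 2 * b / (8 * (C₁ + C₂)), by positivity, N₀ + 1, fun N hN U hU => ?_⟩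
  have hN0 : 0 < N := by omega
  have hNR : (0 : ℝ) < N := by exact_mod_cast hN0
  have hunit : IsUnit (avgInfo σ τ β N) :=
    (isUnit_and_norm_inv_le_of_coercive (c := ε * N) (by positivity) (hcoer N (by omega))).1
  set J := avgInfo σ τ β N with hJ
  set M : Fin N → Matrix (Param L) (Param L) ℝ := fun n => infoDensity σ τ β (freq n) with hM
  set V := dftMatrix N * U with hV
  have hVu : V ∈ Matrix.unitaryGroup (Fin N) ℂ :=
    mul_mem (dftMatrix_mem_unitaryGroup hN0) hU.1
  set W : Fin N → Fin N → ℝ := fun n i => ‖V n i‖ ^ 2 with hW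
  have hrow : ∀ n, ∑ i, W n i = 1 := sum_row_power hVu
  have hcol : ∀ i, ∑ n, W n i = 1 := sum_col_power hVu
  have hspread : ∀ i (a : ℝ), α ^ 2 ≤ ∑ m, W m i * (a - freq m) ^ 2 := by
    intro i a
    have hps : ∀ m, powerSpectrum (fun k => U k i) m = W m i := fun m => rfl
    have h1 := hU.2 i
    rw [rmsBandwidth] at h1
    have h2 : α ^ 2 ≤ ∑ k, (freq k - centroid fun k => U k i) ^ 2
        * powerSpectrum (fun k => U k i) k := by
      rw [← Real.le_sqrt' hα]; exact h1
    refine h2.trans ?_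
    simp only [centroid, hps]
    exact sum_sq_sub_centroid_le (fun m => W m i) freq (hcol i) a
  -- the two coordinates of `M_n H w₂` that separate frequencies
  set φ : Fin N → ℝ := fun n => w₂ ⬝ᵥ (M n * J⁻¹) *ᵥ w₂ with hφ
  have hφsum : ∑ n, φ n = b := by
    have h1 : ∑ n, φ n = w₂ ⬝ᵥ ((∑ n, M n) * J⁻¹) *ᵥ w₂ := by
      rw [Finset.sum_mul, dotProduct_sum_mulVec]
    rw [h1]
    change w₂ ⬝ᵥ (J * J⁻¹) *ᵥ w₂ = b
    rw [Matrix.mul_nonsing_inv _ ((Matrix.isUnit_iff_isUnit_det _).1 hunit), Matrix.one_mulVec,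
      ← hvv, hw₂]
    simp [dotProduct, Fintype.sum_sum_type]
  have hφ₁ : ∀ n, w₁ ⬝ᵥ (M n * J⁻¹) *ᵥ w₂ = -(2 * Real.pi * freq n) * φ n := by
    intro n
    simp only [hφ, ← Matrix.mulVec_mulVec]
    exact delay_row_eq σ τ β (freq n) l₀ _
  set D : ℝ := b * ((C₁ + C₂) * N) with hD
  have hD0 : 0 < D := by positivity
  set t : Fin N → Fin N → ℝ := fun n m => crbForm σ τ β N (M n) (M m) with ht
  have hpair : ∀ n m, (freq n - freq m) ^ 2 * φ n ^ 2 / (4 * D)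
      ≤ t n n - t n m - t m n + t m m := by
    intro n m
    simp only [ht]
    rw [← crbForm_sub_sub]
    set X := M n - M m with hX
    have hXt : Xᵀ = X := by
      simp only [hX, hM, Matrix.transpose_sub, infoDensity_transpose]
    set q := crbForm σ τ β N X X with hq
    have hsub : ∀ w : Param L → ℝ, w ⬝ᵥ (X * J⁻¹) *ᵥ w₂
        = w ⬝ᵥ (M n * J⁻¹) *ᵥ w₂ - w ⬝ᵥ (M m * J⁻¹) *ᵥ w₂ := by
      intro w
      rw [hX, sub_mul, Matrix.sub_mulVec, dotProduct_sub]
    have h1 := sq_le_crbForm σ τ β hunit hXt w₁ v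
    have h2 := sq_le_crbForm σ τ β hunit hXt w₂ v
    rw [← hw₂, ← hJ, hsub, hvv, ← hq] at h1 h2
    rw [hφ₁, hφ₁] at h1
    change (φ n - φ m) ^ 2 ≤ _ at h2
    have hq0 : 0 ≤ q := crbForm_self_nonneg σ τ β hunit hXt
    have h1' : (2 * Real.pi) ^ 2 * (freq n * φ n - freq m * φ m) ^ 2 ≤ D * q := by
      calc (2 * Real.pi) ^ 2 * (freq n * φ n - freq m * φ m) ^ 2
          = (-(2 * Real.pi * freq n) * φ n - -(2 * Real.pi * freq m) * φ m) ^ 2 := by ring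
        _ ≤ b * (w₁ ⬝ᵥ J *ᵥ w₁) * q := h1
        _ ≤ D * q := by
            rw [hD]; gcongr
            refine (hJ₁ N).trans ?_
            gcongr; linarith
    have h2' : (φ n - φ m) ^ 2 ≤ D * q := by
      refine h2.trans ?_
      rw [hD]; gcongr
      refine (hJ₂ N).trans ?_
      gcongr; linarith
    have h1'' : (freq n * φ n - freq m * φ m) ^ 2 ≤ D * q := by
      refine le_trans ?_ h1'
      have hpi : 1 ≤ (2 * Real.pi) ^ 2 := one_le_pow₀ (by linarith [Real.pi_gt_three])
      exact le_mul_of_one_le_left (sq_nonneg _) hpi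
    rw [div_le_iff₀ (by positivity)]
    -- `(f - f') φ = (f φ - f' φ') - f' (φ - φ')`
    have h3 : (freq n - freq m) ^ 2 * φ n ^ 2
        ≤ 2 * (freq n * φ n - freq m * φ m) ^ 2 + 2 * (freq m ^ 2 * (φ n - φ m) ^ 2) := by
      nlinarith [sq_nonneg ((freq n * φ n - freq m * φ m) + freq m * (φ n - φ m))]
    have hfm := freq_mem_Icc m
    have h4 : freq m ^ 2 * (φ n - φ m) ^ 2 ≤ (φ n - φ m) ^ 2 :=
      mul_le_of_le_one_left (sq_nonneg _) (pow_le_one₀ hfm.1 hfm.2)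
    linarith
  change _ ≤ ∑ n, ∑ m, ((if n = m then 1 else 0) - ∑ i, W n i * W m i) * t n m
  rw [sum_one_sub_gram_mul W t hrow hcol]
  have hW0 : ∀ n i, 0 ≤ W n i := fun n i => by positivity
  have hφsq : b ^ 2 / N ≤ ∑ n, φ n ^ 2 := by
    rw [div_le_iff₀ hNR, ← hφsum]
    have := sq_sum_le_card_mul_sum_sq (s := (Finset.univ : Finset (Fin N))) (f := φ)
    simp only [Finset.card_univ, Fintype.card_fin] at this
    linarith
  calc α ^ 2 * b / (8 * (C₁ + C₂)) / (N : ℝ) ^ 2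
      = 1 / 2 * (α ^ 2 / (4 * D) * (b ^ 2 / N)) := by
        rw [hD]; field_simp; ring
    _ ≤ 1 / 2 * (α ^ 2 / (4 * D) * ∑ n, φ n ^ 2) := by gcongr
    _ = 1 / 2 * ∑ i, ∑ n, W n i * φ n ^ 2 / (4 * D) * α ^ 2 := by
        congr 1
        rw [Finset.sum_comm, Finset.mul_sum]
        refine Finset.sum_congr rfl fun n _ => ?_
        rw [← Finset.sum_mul, ← Finset.sum_div, ← Finset.sum_mul, hrow]
        ring
    _ ≤ 1 / 2 * ∑ i, ∑ n, W n i * φ n ^ 2 / (4 * D) * ∑ m, W m i * (freq n - freq m) ^ 2 := by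
        gcongr with i _ n _
        exact hspread i (freq n)
    _ = 1 / 2 * ∑ i, ∑ n, ∑ m, W n i * W m i * ((freq n - freq m) ^ 2 * φ n ^ 2 / (4 * D)) := by
        congr 1
        refine Finset.sum_congr rfl fun i _ => Finset.sum_congr rfl fun n _ => ?_
        rw [Finset.mul_sum]
        exact Finset.sum_congr rfl fun m _ => by ring
    _ ≤ _ := by
        gcongr with i _ n _ m _
        exact hpair n m

end SecondOrder

/-! ### Comparison of the conditional amplitude bounds -/

section Comparison

open scoped Matrix.Norms.L2Operator

variable {S : Finset ℂ} {σ : ℝ} {L : ℕ} {τ : Fin L → ℝ} {β : Fin L → ℂ}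

lemma expect_norm_pow_four_eq_kurtosis (hmean : 𝔼 s ∈ S, s = 0)
    (hpower : 𝔼 s ∈ S, ‖s‖ ^ 2 = 1) : 𝔼 s ∈ S, ‖s‖ ^ 4 = kurtosis S := by
  simp [kurtosis, hmean, hpower]

/-- The deviation of the Fisher information from its mean. -/
lemma fim_sub_avgInfo {N : ℕ} (hN : 0 < N) (U : Matrix (Fin N) (Fin N) ℂ) (s : Fin N → ℂ) :
    fim σ τ β U s - avgInfo σ τ β N =
      ∑ n, (binPower (dftMatrix N * U) s n - 1) • infoDensity σ τ β (freq n) := by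
  rw [fim_eq_sum hN, avgInfo, ← Finset.sum_sub_distrib]
  exact Finset.sum_congr rfl fun n _ => by rw [sub_smul, one_smul]

/-- The Fisher information deviates from its mean by `O(√N)` in fourth mean, uniformly in the
unitary waveform. -/
lemma exists_expect_norm_deviation_pow_four_le (hmean : 𝔼 s ∈ S, s = 0)
    (hpower : 𝔼 s ∈ S, ‖s‖ ^ 2 = 1) (σ : ℝ) (τ : Fin L → ℝ) (β : Fin L → ℂ) :
    ∃ K : ℝ, 0 < K ∧ ∀ N : ℕ, 0 < N → ∀ U ∈ Matrix.unitaryGroup (Fin N) ℂ,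
      𝔼 s ∈ symbolVectors S N, ‖fim σ τ β U s - avgInfo σ τ β N‖ ^ 4 ≤ K * (N : ℝ) ^ 2 := by
  obtain ⟨C, hC, hM⟩ := exists_infoDensity_bound σ τ β
  obtain ⟨C', hC', hnorm⟩ := exists_norm_pow_four_le (Param L)
  set B : ℝ := ∑ s ∈ S, ‖s‖ + 1 with hBdef
  have hB1 : 1 ≤ B := by
    have : 0 ≤ ∑ s ∈ S, ‖s‖ := by positivity
    linarith
  have hB : ∀ s ∈ S, ‖s‖ ≤ B := fun s hs => by
    have := Finset.single_le_sum (f := fun s : ℂ => ‖s‖) (fun _ _ => norm_nonneg _) hs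
    linarith
  set d : ℝ := (Fintype.card (Param L) : ℝ) with hd
  refine ⟨C' * (d * (d * (400 * B ^ 4 * C ^ 2) ^ 2)) + 1, by positivity, fun N hN U hU => ?_⟩
  have hV : dftMatrix N * U ∈ Matrix.unitaryGroup (Fin N) ℂ :=
    mul_mem (dftMatrix_mem_unitaryGroup hN) hU
  have hentry : ∀ k l, 𝔼 s ∈ symbolVectors S N, (fim σ τ β U s - avgInfo σ τ β N) k l ^ 4
      ≤ (400 * B ^ 4 * C ^ 2) ^ 2 * (N : ℝ) ^ 2 := by
    intro k l
    have h1 : ∀ s, (fim σ τ β U s - avgInfo σ τ β N) k l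
        = ∑ n, infoDensity σ τ β (freq n) k l * (binPower (dftMatrix N * U) s n - 1) := by
      intro s
      rw [fim_sub_avgInfo hN, Matrix.sum_apply]
      exact Finset.sum_congr rfl fun n _ => by rw [Matrix.smul_apply, smul_eq_mul, mul_comm]
    simp only [h1]
    refine (expect_weighted_binPower_pow_four hmean hpower hB hB1 hV _).trans ?_
    rw [← mul_pow]
    have h2 : ∑ n : Fin N, infoDensity σ τ β (freq n) k l ^ 2 ≤ C ^ 2 * N := by
      calc ∑ n : Fin N, infoDensity σ τ β (freq n) k l ^ 2 ≤ ∑ _n : Fin N, C ^ 2 := by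
            refine Finset.sum_le_sum fun n _ => ?_
            rw [← sq_abs]
            gcongr
            exact hM _ (freq_mem_Icc n) k l
        _ = C ^ 2 * N := by simp [mul_comm]
    have h3 : 400 * B ^ 4 * ∑ n : Fin N, infoDensity σ τ β (freq n) k l ^ 2
        ≤ 400 * B ^ 4 * C ^ 2 * N := by
      rw [mul_assoc _ (C ^ 2)]; gcongr
    exact pow_le_pow_left₀ (by positivity) h3 2
  calc 𝔼 s ∈ symbolVectors S N, ‖fim σ τ β U s - avgInfo σ τ β N‖ ^ 4
      ≤ 𝔼 s ∈ symbolVectors S N, C' * ∑ k, ∑ l, (fim σ τ β U s - avgInfo σ τ β N) k l ^ 4 :=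
        Finset.expect_le_expect fun s _ => hnorm _
    _ = C' * ∑ k, ∑ l, 𝔼 s ∈ symbolVectors S N, (fim σ τ β U s - avgInfo σ τ β N) k l ^ 4 := by
        rw [← Finset.mul_expect, Finset.expect_sum_comm]
        simp only [Finset.expect_sum_comm]
    _ ≤ C' * ∑ _k : Param L, ∑ _l : Param L, (400 * B ^ 4 * C ^ 2) ^ 2 * (N : ℝ) ^ 2 := by
        gcongr with k _ l _
        exact hentry k l
    _ = C' * (d * (d * (400 * B ^ 4 * C ^ 2) ^ 2)) * (N : ℝ) ^ 2 := by
        simp only [Finset.sum_const, Finset.card_univ, nsmul_eq_mul, ← hd]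
        ring
    _ ≤ _ := by gcongr; linarith

/-- The Fisher information of OFDM dominates a multiple of its mean for every symbol vector. -/
lemma exists_ofdm_coercive (hzero : ∀ s ∈ S, s ≠ 0) (hS : S.Nonempty) :
    ∃ m : ℝ, 0 < m ∧ ∀ N : ℕ, 0 < N → ∀ s ∈ symbolVectors S N, ∀ x : Param L → ℝ,
      m * (x ⬝ᵥ avgInfo σ τ β N *ᵥ x) ≤ x ⬝ᵥ fim σ τ β (ofdm N) s *ᵥ x := by
  obtain ⟨z, hz, hmin⟩ := S.exists_min_image (fun s => ‖s‖) hS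
  refine ⟨‖z‖ ^ 2, by have := norm_pos_iff.2 (hzero z hz); positivity, fun N hN s hs x => ?_⟩
  rw [fim_eq_sum hN, avgInfo, dotProduct_sum_mulVec, dotProduct_sum_mulVec, Finset.mul_sum]
  refine Finset.sum_le_sum fun n _ => ?_
  rw [Matrix.smul_mulVec, dotProduct_smul, smul_eq_mul, binPower, dftMatrix_mul_ofdm hN,
    Matrix.one_mulVec]
  refine mul_le_mul_of_nonneg_right ?_ (infoDensity_nonneg σ τ β _ x)
  gcongr
  exact hmin _ (Fintype.mem_piFinset.1 hs n)

/-- The average of the second-order term, through the covariance of the bin powers. -/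
lemma expect_crbForm_deviation (hmean : 𝔼 s ∈ S, s = 0) (hpower : 𝔼 s ∈ S, ‖s‖ ^ 2 = 1)
    (hpseudo : 𝔼 s ∈ S, s ^ 2 = 0) {N : ℕ} (hN : 0 < N) {U : Matrix (Fin N) (Fin N) ℂ}
    (hU : U ∈ Matrix.unitaryGroup (Fin N) ℂ) :
    𝔼 s ∈ symbolVectors S N, crbForm σ τ β N (fim σ τ β U s - avgInfo σ τ β N)
        (fim σ τ β U s - avgInfo σ τ β N) =
      ∑ n, ∑ m, ((if n = m then 1 else 0) - (2 - kurtosis S) *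
        ∑ i, ‖(dftMatrix N * U) n i‖ ^ 2 * ‖(dftMatrix N * U) m i‖ ^ 2) *
          crbForm σ τ β N (infoDensity σ τ β (freq n)) (infoDensity σ τ β (freq m)) := by
  have hV : dftMatrix N * U ∈ Matrix.unitaryGroup (Fin N) ℂ :=
    mul_mem (dftMatrix_mem_unitaryGroup hN) hU
  simp only [fim_sub_avgInfo hN, crbForm_sum_smul, Finset.expect_sum_comm, ← Finset.expect_mul]
  refine Finset.sum_congr rfl fun n _ => Finset.sum_congr rfl fun m _ => ?_
  rw [← expect_binPower_covariance hmean hpower hpseudo _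
    (expect_norm_pow_four_eq_kurtosis hmean hpower) hV n m]
  rfl

/-- For OFDM the Gram matrix of the column spectra is the identity, so the second-order terms of
a waveform and of OFDM differ by `2 - κ` times the covariance defect. -/
lemma expect_crbForm_sub_ofdm (hmean : 𝔼 s ∈ S, s = 0) (hpower : 𝔼 s ∈ S, ‖s‖ ^ 2 = 1)
    (hpseudo : 𝔼 s ∈ S, s ^ 2 = 0) {N : ℕ} (hN : 0 < N) {U : Matrix (Fin N) (Fin N) ℂ}
    (hU : U ∈ Matrix.unitaryGroup (Fin N) ℂ) :
    (𝔼 s ∈ symbolVectors S N, crbForm σ τ β N (fim σ τ β U s - avgInfo σ τ β N)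
        (fim σ τ β U s - avgInfo σ τ β N)) -
      𝔼 s ∈ symbolVectors S N, crbForm σ τ β N (fim σ τ β (ofdm N) s - avgInfo σ τ β N)
        (fim σ τ β (ofdm N) s - avgInfo σ τ β N) =
      (2 - kurtosis S) * ∑ n, ∑ m, ((if n = m then 1 else 0) -
        ∑ i, ‖(dftMatrix N * U) n i‖ ^ 2 * ‖(dftMatrix N * U) m i‖ ^ 2) *
          crbForm σ τ β N (infoDensity σ τ β (freq n)) (infoDensity σ τ β (freq m)) := by
  have hone : ∀ n m : Fin N, ∑ i, ‖(1 : Matrix (Fin N) (Fin N) ℂ) n i‖ ^ 2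
      * ‖(1 : Matrix (Fin N) (Fin N) ℂ) m i‖ ^ 2 = if n = m then (1 : ℝ) else 0 := by
    intro n m
    rw [Finset.sum_eq_single n]
    · by_cases h : n = m
      · subst h; simp
      · simp [h, Matrix.one_apply_ne (Ne.symm h)]
    · intro i _ hi
      simp [Matrix.one_apply_ne (Ne.symm hi)]
    · simp
  rw [expect_crbForm_deviation hmean hpower hpseudo hN hU,
    expect_crbForm_deviation hmean hpower hpseudo hN (ofdm_mem_unitaryGroup hN),
    dftMatrix_mul_ofdm hN]
  simp only [hone, ← Finset.sum_sub_distrib, Finset.mul_sum]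
  refine Finset.sum_congr rfl fun n _ => Finset.sum_congr rfl fun m _ => ?_
  rw [← Finset.mul_sum]
  ring

/-- Third-order accuracy of the second-order expansion of the conditional amplitude bound, on
events of probability `1 - O(N⁻²)` on which the inverse Fisher information is `O(N⁻¹)`. -/
lemma exists_condAmpCRB_expansion (hmean : 𝔼 s ∈ S, s = 0) (hpower : 𝔼 s ∈ S, ‖s‖ ^ 2 = 1)
    (hσ : 0 < σ) (hτ : Function.Injective τ) (hβ : ∀ l, β l ≠ 0) {G : ℝ} (hG : 0 < G) :
    ∃ R : ℝ, 0 < R ∧ ∃ N₀ : ℕ, ∀ N ≥ N₀, ∀ U ∈ Matrix.unitaryGroup (Fin N) ℂ,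
      ∀ A ⊆ symbolVectors S N,
        ((symbolVectors S N \ A).card : ℝ) ≤ G / (N : ℝ) ^ 2 * (symbolVectors S N).card →
        (∀ s ∈ A, IsUnit (fim σ τ β U s) ∧ ‖(fim σ τ β U s)⁻¹‖ ≤ G / N) →
        |condAmpCRB σ τ β U A
            - (((ampSelection L)ᵀ * ampSelection L) * (avgInfo σ τ β N)⁻¹).trace
            - 𝔼 s ∈ symbolVectors S N, crbForm σ τ β N (fim σ τ β U s - avgInfo σ τ β N)
                (fim σ τ β U s - avgInfo σ τ β N)| ≤ R / Real.sqrt N ^ 5 := by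
  obtain ⟨ε, hε, N₁, hcoer⟩ := exists_avgInfo_coercive hσ hτ hβ
  obtain ⟨K₀, hK₀, hmoment⟩ := exists_expect_norm_deviation_pow_four_le hmean hpower σ τ β
  obtain ⟨CT, hCT, htrace⟩ := exists_abs_trace_mul_le ((ampSelection L)ᵀ * ampSelection L)
  set h : ℝ := 1 / ε with hh
  have hpos : 0 < h := by positivity
  set C := CT * (h ^ 2 + h ^ 3 + h ^ 3 * G) with hC
  set K := K₀ + G with hK
  refine ⟨2 * C * (2 + 6 * K + K ^ 2), by positivity, max N₁ (⌈2 * G⌉₊ + 1),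
    fun N hN U hU A hA hcompl hinv => ?_⟩
  have hN₁ : N₁ ≤ N := le_of_max_le_left hN
  have hN₂ : ⌈2 * G⌉₊ + 1 ≤ N := le_of_max_le_right hN
  have hN0 : 0 < N := by omega
  have hNR : (0 : ℝ) < N := by exact_mod_cast hN0
  have hN1 : (1 : ℝ) ≤ N := by exact_mod_cast hN0
  have hNG : 2 * G ≤ N := by
    refine (Nat.le_ceil _).trans ?_
    exact_mod_cast (by omega : ⌈2 * G⌉₊ ≤ N)
  set q := Real.sqrt N with hq
  have hq1 : 1 ≤ q := Real.one_le_sqrt.2 hN1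
  have hq0 : 0 < q := by linarith
  have hqN : (N : ℝ) = q ^ 2 := (Real.sq_sqrt hNR.le).symm
  set P := symbolVectors S N with hP
  have hPne : P.Nonempty := Fintype.piFinset_nonempty.2 fun _ => symbols_nonempty hpower
  have hPcard : (0 : ℝ) < P.card := by exact_mod_cast hPne.card_pos
  obtain ⟨hunit, hHnorm⟩ :=
    isUnit_and_norm_inv_le_of_coercive (c := ε * N) (by positivity) (hcoer N hN₁)
  set J := avgInfo σ τ β N with hJ
  set H := J⁻¹ with hH
  have hHq : ‖H‖ ≤ h / q ^ 2 := by
    refine hHnorm.trans (le_of_eq ?_)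
    rw [hh, ← hqN]; field_simp
  set Δ : (Fin N → ℂ) → Matrix (Param L) (Param L) ℝ := fun s => fim σ τ β U s - J with hΔ
  set y : (Fin N → ℂ) → ℝ := fun s => ‖Δ s‖ / q with hy
  have hy0 : ∀ s, 0 ≤ y s := fun s => by positivity
  have hΔy : ∀ s, ‖Δ s‖ = q * y s := fun s => by rw [hy]; field_simp
  have hsplit : (P.card : ℝ) = (P \ A).card + A.card := by
    rw [← Nat.cast_add, Finset.card_sdiff_add_card_eq_card hA]
  have hGN : G / (N : ℝ) ^ 2 ≤ 1 / 2 := by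
    rw [div_le_iff₀ (by positivity)]
    nlinarith
  have hhalf : (P.card : ℝ) ≤ 2 * A.card := by
    have : G / (N : ℝ) ^ 2 * P.card ≤ 1 / 2 * P.card :=
      mul_le_mul_of_nonneg_right hGN hPcard.le
    linarith
  have hAne : A.Nonempty := by
    rw [← Finset.card_pos]
    have : (0 : ℝ) < A.card := by linarith
    exact_mod_cast this
  have h12 : ∀ s, ‖H * Δ s‖ ≤ h / q ^ 2 * (q * y s) := fun s =>
    norm_mul_le_of_le hHq (hΔy s).le
  have h1 : ∀ s, ‖H * Δ s * H‖ ≤ h / q ^ 2 * (q * y s) * (h / q ^ 2) := fun s =>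
    norm_mul_le_of_le (h12 s) hHq
  have h2 : ∀ s, ‖H * Δ s * H * Δ s * H‖
      ≤ h / q ^ 2 * (q * y s) * (h / q ^ 2) * (q * y s) * (h / q ^ 2) := fun s =>
    norm_mul_le_of_le (norm_mul_le_of_le (h1 s) (hΔy s).le) hHq
  refine abs_expect_sub_le_of_expansion hA
    (f := fun s => ampCRB σ τ β U s)
    (f₁ := fun s => (((ampSelection L)ᵀ * ampSelection L) * (H * Δ s * H)).trace)
    (f₂ := fun s => crbForm σ τ β N (Δ s) (Δ s)) (y := y) hq1 (by positivity)
    (by positivity) ?_ ?_ ?_ ?_ ?_ ?_ hhalf hAne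
  · have h3 : 𝔼 s ∈ P, y s ^ 4 = (𝔼 s ∈ P, ‖Δ s‖ ^ 4) / q ^ 4 := by
      rw [Finset.expect_div]
      exact Finset.expect_congr rfl fun s _ => by rw [hy, div_pow]
    rw [h3, div_le_iff₀ (by positivity)]
    calc 𝔼 s ∈ P, ‖Δ s‖ ^ 4 ≤ K₀ * (N : ℝ) ^ 2 := hmoment N hN0 U hU
      _ = K₀ * q ^ 4 := by rw [hqN]; ring
      _ ≤ K * q ^ 4 := by gcongr; linarith
  · have hV : dftMatrix N * U ∈ Matrix.unitaryGroup (Fin N) ℂ :=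
      mul_mem (dftMatrix_mem_unitaryGroup hN0) hU
    have h3 : ∀ s, (((ampSelection L)ᵀ * ampSelection L) * (H * Δ s * H)).trace
        = ∑ n, (binPower (dftMatrix N * U) s n - 1) *
          (((ampSelection L)ᵀ * ampSelection L) *
            (H * infoDensity σ τ β (freq n) * H)).trace := by
      intro s
      simp only [hΔ, hJ, fim_sub_avgInfo hN0, Finset.mul_sum, Finset.sum_mul, Matrix.trace_sum,
        Matrix.mul_smul, Matrix.smul_mul, Matrix.trace_smul, smul_eq_mul]
    simp only [h3, Finset.expect_sum_comm, ← Finset.expect_mul, Finset.expect_sub_distrib,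
      Finset.expect_const hPne]
    refine Finset.sum_eq_zero fun n _ => ?_
    have h4 : 𝔼 s ∈ P, binPower (dftMatrix N * U) s n = 1 := expect_binPower hmean hpower hV n
    rw [h4, sub_self, zero_mul]
  · intro s _
    refine (htrace _).trans ?_
    calc CT * ‖H * Δ s * H‖ ≤ CT * (h / q ^ 2 * (q * y s) * (h / q ^ 2)) := by
          gcongr; exact h1 s
      _ = CT * h ^ 2 / q ^ 3 * y s := by field_simp
      _ ≤ C / q ^ 3 * y s := by
          have := hy0 s
          gcongr
          rw [hC]; gcongr
          have : 0 < h ^ 3 + h ^ 3 * G := by positivity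
          linarith
  · intro s _
    refine (htrace _).trans ?_
    calc CT * ‖H * Δ s * H * Δ s * H‖
        ≤ CT * (h / q ^ 2 * (q * y s) * (h / q ^ 2) * (q * y s) * (h / q ^ 2)) := by
          gcongr; exact h2 s
      _ = CT * h ^ 3 / q ^ 4 * y s ^ 2 := by field_simp
      _ ≤ C / q ^ 4 * y s ^ 2 := by
          gcongr
          rw [hC]; gcongr
          have : 0 < h ^ 2 + h ^ 3 * G := by positivity
          linarith
  · intro s hs
    obtain ⟨hJs, hJsn⟩ := hinv s hs
    have h3 : ampCRB σ τ β U s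
        - ((((ampSelection L)ᵀ * ampSelection L) * H).trace
          - (((ampSelection L)ᵀ * ampSelection L) * (H * Δ s * H)).trace
          + crbForm σ τ β N (Δ s) (Δ s))
        = -(((ampSelection L)ᵀ * ampSelection L) *
            (H * Δ s * H * Δ s * H * Δ s * (fim σ τ β U s)⁻¹)).trace := by
      have h4 := congrArg (fun X => (((ampSelection L)ᵀ * ampSelection L) * X).trace)
        (inv_eq_neumann hunit hJs)
      simp only [mul_sub ((ampSelection L)ᵀ * ampSelection L),
        mul_add ((ampSelection L)ᵀ * ampSelection L), Matrix.trace_sub, Matrix.trace_add] at h4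
      rw [ampCRB, crbForm, h4]
      ring
    rw [h3, abs_neg]
    refine (htrace _).trans ?_
    have hJq : ‖(fim σ τ β U s)⁻¹‖ ≤ G / q ^ 2 := by rw [← hqN]; exact hJsn
    calc CT * ‖H * Δ s * H * Δ s * H * Δ s * (fim σ τ β U s)⁻¹‖
        ≤ CT * (h / q ^ 2 * (q * y s) * (h / q ^ 2) * (q * y s) * (h / q ^ 2) * (q * y s)
          * (G / q ^ 2)) := by
          gcongr
          exact norm_mul_le_of_le (norm_mul_le_of_le (h2 s) (hΔy s).le) hJq
      _ = CT * (h ^ 3 * G) / q ^ 5 * y s ^ 3 := by field_simp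
      _ ≤ C / q ^ 5 * y s ^ 3 := by
          have := hy0 s
          gcongr
          rw [hC]; gcongr
          have : 0 < h ^ 2 + h ^ 3 := by positivity
          linarith
  · refine hcompl.trans ?_
    have : q ^ 4 = (N : ℝ) ^ 2 := by rw [hqN]; ring
    rw [this]
    refine mul_le_mul_of_nonneg_right ?_ hPcard.le
    gcongr
    linarith

/-- The complement of the event `Ω_N` has probability `O(N⁻²)`, uniformly in the unitary waveform;
on the event the inverse Fisher information is `O(N⁻¹)`. -/
lemma exists_goodEvent_bounds (hmean : 𝔼 s ∈ S, s = 0) (hpower : 𝔼 s ∈ S, ‖s‖ ^ 2 = 1)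
    (hσ : 0 < σ) (hτ : Function.Injective τ) (hβ : ∀ l, β l ≠ 0) {ρ : ℝ} (hρ0 : 0 < ρ)
    (hρ1 : ρ < 1) :
    ∃ G : ℝ, 0 < G ∧ ∃ N₀ : ℕ, ∀ N ≥ N₀, ∀ U ∈ Matrix.unitaryGroup (Fin N) ℂ,
      ((symbolVectors S N \ goodEvent S σ τ β ρ U).card : ℝ)
          ≤ G / (N : ℝ) ^ 2 * (symbolVectors S N).card ∧
      ∀ s ∈ goodEvent S σ τ β ρ U,
        IsUnit (fim σ τ β U s) ∧ ‖(fim σ τ β U s)⁻¹‖ ≤ G / N := by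
  obtain ⟨ε, hε, N₁, hcoer⟩ := exists_avgInfo_coercive hσ hτ hβ
  obtain ⟨K, hK, hmoment⟩ := exists_expect_norm_deviation_pow_four_le hmean hpower σ τ β
  have hρ' : 0 < 1 - ρ := by linarith
  refine ⟨K / (ρ * ε) ^ 4 + 1 / (1 - ρ) * (1 / ε), by positivity, N₁ + 1, fun N hN U hU => ?_⟩
  have hN0 : 0 < N := by omega
  have hNR : (0 : ℝ) < N := by exact_mod_cast hN0
  obtain ⟨hunit, hHnorm⟩ :=
    isUnit_and_norm_inv_le_of_coercive (c := ε * N) (by positivity) (hcoer N (by omega))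
  have hmem : ∀ s, s ∈ goodEvent S σ τ β ρ U ↔ s ∈ symbolVectors S N ∧
      ‖(avgInfo σ τ β N)⁻¹ * (fim σ τ β U s - avgInfo σ τ β N)‖ < ρ := by
    intro s
    rw [goodEvent, Finset.mem_filter, fluctuation, meanFim_eq_avgInfo hN0 hmean hpower σ τ β hU,
      Matrix.l2_opNorm_toEuclideanCLM]
  constructor
  · -- Markov's inequality for the fourth power
    have hPne : (symbolVectors S N).Nonempty :=
      Fintype.piFinset_nonempty.2 fun _ => symbols_nonempty hpower
    have hPcard : (0 : ℝ) < (symbolVectors S N).card := by exact_mod_cast hPne.card_pos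
    have hsum : ∑ s ∈ symbolVectors S N, ‖fim σ τ β U s - avgInfo σ τ β N‖ ^ 4
        ≤ K * (N : ℝ) ^ 2 * (symbolVectors S N).card := by
      have := hmoment N hN0 U hU
      rwa [Finset.expect_eq_sum_div_card, div_le_iff₀ hPcard] at this
    have hlow : ∀ s ∈ symbolVectors S N \ goodEvent S σ τ β ρ U,
        (ρ * ε * N) ^ 4 ≤ ‖fim σ τ β U s - avgInfo σ τ β N‖ ^ 4 := by
      intro s hs
      rw [Finset.mem_sdiff, hmem, not_and, not_lt] at hs
      have h1 := hs.2 hs.1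
      have h2 : ρ ≤ 1 / (ε * N) * ‖fim σ τ β U s - avgInfo σ τ β N‖ :=
        h1.trans (norm_mul_le_of_le hHnorm le_rfl)
      rw [one_div, ← div_eq_inv_mul, le_div_iff₀ (by positivity), ← mul_assoc] at h2
      gcongr
    have h1 : ((symbolVectors S N \ goodEvent S σ τ β ρ U).card : ℝ) * (ρ * ε * N) ^ 4
        ≤ K * (N : ℝ) ^ 2 * (symbolVectors S N).card := by
      calc ((symbolVectors S N \ goodEvent S σ τ β ρ U).card : ℝ) * (ρ * ε * N) ^ 4
          = ∑ _s ∈ symbolVectors S N \ goodEvent S σ τ β ρ U, (ρ * ε * N) ^ 4 := by simp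
        _ ≤ ∑ s ∈ symbolVectors S N \ goodEvent S σ τ β ρ U,
              ‖fim σ τ β U s - avgInfo σ τ β N‖ ^ 4 := Finset.sum_le_sum hlow
        _ ≤ ∑ s ∈ symbolVectors S N, ‖fim σ τ β U s - avgInfo σ τ β N‖ ^ 4 :=
            Finset.sum_le_sum_of_subset_of_nonneg Finset.sdiff_subset
              fun _ _ _ => by positivity
        _ ≤ _ := hsum
    rw [← le_div_iff₀ (by positivity)] at h1
    refine h1.trans ?_
    calc K * (N : ℝ) ^ 2 * (symbolVectors S N).card / (ρ * ε * N) ^ 4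
        = K / (ρ * ε) ^ 4 / (N : ℝ) ^ 2 * (symbolVectors S N).card := by field_simp
      _ ≤ _ := by
          gcongr
          have : 0 < 1 / (1 - ρ) * (1 / ε) := by positivity
          linarith
  · intro s hs
    obtain ⟨hJ, hnorm⟩ := isUnit_and_norm_inv_le_of_relative hunit hρ1 ((hmem s).1 hs).2
    refine ⟨hJ, hnorm.trans ?_⟩
    calc 1 / (1 - ρ) * ‖(avgInfo σ τ β N)⁻¹‖ ≤ 1 / (1 - ρ) * (1 / (ε * N)) := by gcongr
      _ = 1 / (1 - ρ) * (1 / ε) / N := by field_simp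
      _ ≤ _ := by
          gcongr
          have : 0 < K / (ρ * ε) ^ 4 := by positivity
          linarith

end Comparison

end

end OFDMCRB

theorem corollary2
    -- the constellation: uniform on `S`, unit power, second-order and central symmetry,
    -- no zero symbol, sub-Gaussian
    (S : Finset ℂ)
    (hpower : 𝔼 s ∈ S, ‖s‖ ^ 2 = 1)
    (hmean : 𝔼 s ∈ S, s = 0)
    (hpseudo : 𝔼 s ∈ S, s ^ 2 = 0)
    (hsymm : ∀ s ∈ S, -s ∈ S)
    (hzero : ∀ s ∈ S, s ≠ 0)
    (hkurt : OFDMCRB.kurtosis S < 2)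
    -- the noise level and the non-degenerate targets
    (σ : ℝ) (hσ : 0 < σ)
    (L : ℕ) (hL : 0 < L)
    (τ : Fin L → ℝ) (hτ : Function.Injective τ)
    (β : Fin L → ℂ) (hβ : ∀ l, β l ≠ 0)
    -- the radius that defines `Ω_N`
    (ρ : ℝ) (hρ0 : 0 < ρ) (hρ1 : ρ < 1)
    -- an `α`-frequency-spread waveform, that is, one basis for each block length `N`
    (α : ℝ) (hα : 0 < α)
    (U : ∀ N : ℕ, Matrix (Fin N) (Fin N) ℂ)
    (hU : ∀ᶠ N in Filter.atTop, OFDMCRB.IsFrequencySpread α (U N)) :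
    ∃ c : ℝ, 0 < c ∧ ∃ N₀ : ℕ, 0 < N₀ ∧ ∀ N : ℕ, N₀ ≤ N →
      -- the quantities below are well defined
      (OFDMCRB.goodEvent S σ τ β ρ (U N) ∩
          OFDMCRB.goodEvent S σ τ β ρ (OFDMCRB.ofdm N)).Nonempty ∧
      (∀ s ∈ OFDMCRB.goodEvent S σ τ β ρ (U N), IsUnit (OFDMCRB.fim σ τ β (U N) s)) ∧
      (∀ s ∈ OFDMCRB.symbolVectors S N, IsUnit (OFDMCRB.fim σ τ β (OFDMCRB.ofdm N) s)) ∧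
      -- each CRB conditioned on the event `Ω_N` of its own waveform
      c / (N : ℝ) ^ 2 ≤
        OFDMCRB.condAmpCRB σ τ β (U N) (OFDMCRB.goodEvent S σ τ β ρ (U N)) -
        OFDMCRB.condAmpCRB σ τ β (OFDMCRB.ofdm N)
          (OFDMCRB.goodEvent S σ τ β ρ (OFDMCRB.ofdm N)) ∧
      -- both CRBs conditioned on the event `Ω_N` of the waveform `U`
      c / (N : ℝ) ^ 2 ≤
        OFDMCRB.condAmpCRB σ τ β (U N) (OFDMCRB.goodEvent S σ τ β ρ (U N)) -
        OFDMCRB.condAmpCRB σ τ β (OFDMCRB.ofdm N) (OFDMCRB.goodEvent S σ τ β ρ (U N)) ∧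
      -- both CRBs conditioned on the intersection of the two events
      c / (N : ℝ) ^ 2 ≤
        OFDMCRB.condAmpCRB σ τ β (U N)
          (OFDMCRB.goodEvent S σ τ β ρ (U N) ∩
            OFDMCRB.goodEvent S σ τ β ρ (OFDMCRB.ofdm N)) -
        OFDMCRB.condAmpCRB σ τ β (OFDMCRB.ofdm N)
          (OFDMCRB.goodEvent S σ τ β ρ (U N) ∩
            OFDMCRB.goodEvent S σ τ β ρ (OFDMCRB.ofdm N)) := by
  open OFDMCRB Matrix in
  open scoped Matrix.Norms.L2Operator in
  have hS : S.Nonempty := symbols_nonempty hpower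
  obtain ⟨G₁, hG₁, N₁, hgood⟩ := exists_goodEvent_bounds hmean hpower hσ hτ hβ hρ0 hρ1
  obtain ⟨m, hm, hofdm⟩ := exists_ofdm_coercive (σ := σ) (τ := τ) (β := β) hzero hS
  obtain ⟨ε, hε, N₂, hcoer⟩ := exists_avgInfo_coercive hσ hτ hβ
  set G := 2 * G₁ + 1 / (m * ε) with hG
  have hmε : 0 < 1 / (m * ε) := by positivity
  have hG0 : 0 < G := by positivity
  obtain ⟨R, hR, N₃, hexp⟩ := exists_condAmpCRB_expansion hmean hpower hσ hτ hβ hG0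
  obtain ⟨c₀, hc₀, N₄, hgap⟩ := exists_secondOrder_gap hσ hL hτ hβ hα
  obtain ⟨N₅, hspread⟩ := Filter.eventually_atTop.1 hU
  have hκ : 0 < 2 - kurtosis S := by linarith
  set c₁ := (2 - kurtosis S) * c₀ with hc₁
  have hc₁0 : 0 < c₁ := by positivity
  refine ⟨c₁ / 2, by positivity,
    N₁ + N₂ + N₃ + N₄ + N₅ + ⌈G⌉₊ + ⌈(4 * R / c₁) ^ 2⌉₊ + 1, by omega, fun N hN => ?_⟩
  have hN0 : 0 < N := by omega
  have hNR : (0 : ℝ) < N := by exact_mod_cast hN0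
  have hN1 : (1 : ℝ) ≤ N := by exact_mod_cast hN0
  have hUs := hspread N (by omega)
  have hUu := hUs.1
  have hOu := ofdm_mem_unitaryGroup hN0
  set P := symbolVectors S N with hP
  set A := goodEvent S σ τ β ρ (U N) with hA
  set O := goodEvent S σ τ β ρ (ofdm N) with hO
  have hPcard : (0 : ℝ) < P.card := by
    exact_mod_cast (Fintype.piFinset_nonempty.2 fun _ => hS : P.Nonempty).card_pos
  have hAP : A ⊆ P := Finset.filter_subset _ _
  have hOP : O ⊆ P := Finset.filter_subset _ _
  have hAOP : A ∩ O ⊆ P := Finset.inter_subset_left.trans hAP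
  obtain ⟨hAc, hAinv⟩ := hgood N (by omega) (U N) hUu
  obtain ⟨hOc, -⟩ := hgood N (by omega) (ofdm N) hOu
  have hOinv : ∀ s ∈ P, IsUnit (fim σ τ β (ofdm N) s) ∧ ‖(fim σ τ β (ofdm N) s)⁻¹‖ ≤ G / N := by
    intro s hs
    obtain ⟨h1, h2⟩ := isUnit_and_norm_inv_le_of_coercive (J := fim σ τ β (ofdm N) s)
      (c := m * (ε * N)) (by positivity) (fun x => by
        refine le_trans ?_ (hofdm N hN0 s hs x)
        rw [mul_assoc]
        exact mul_le_mul_of_nonneg_left (hcoer N (by omega) x) hm.le)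
    refine ⟨h1, h2.trans ?_⟩
    calc 1 / (m * (ε * N)) = 1 / (m * ε) / N := by field_simp
      _ ≤ G / N := by gcongr; linarith
  have hAinv' : ∀ s ∈ A, IsUnit (fim σ τ β (U N) s) ∧ ‖(fim σ τ β (U N) s)⁻¹‖ ≤ G / N :=
    fun s hs => ⟨(hAinv s hs).1, (hAinv s hs).2.trans (by gcongr; linarith)⟩
  have hmono : G₁ / (N : ℝ) ^ 2 * P.card ≤ G / (N : ℝ) ^ 2 * P.card := by gcongr; linarith
  have hAOc : ((P \ (A ∩ O)).card : ℝ) ≤ G / (N : ℝ) ^ 2 * P.card := by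
    have h1 : ((P \ (A ∩ O)).card : ℝ) ≤ (P \ A).card + (P \ O).card := by
      rw [Finset.sdiff_inter_distrib_right]
      exact_mod_cast Finset.card_union_le _ _
    calc ((P \ (A ∩ O)).card : ℝ) ≤ G₁ / (N : ℝ) ^ 2 * P.card + G₁ / (N : ℝ) ^ 2 * P.card :=
          h1.trans (add_le_add hAc hOc)
      _ = 2 * G₁ / (N : ℝ) ^ 2 * P.card := by ring
      _ ≤ G / (N : ℝ) ^ 2 * P.card := by gcongr; linarith
  have hnonempty : (A ∩ O).Nonempty := by
    by_contra hempty
    rw [Finset.not_nonempty_iff_eq_empty] at hempty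
    rw [hempty, Finset.sdiff_empty] at hAOc
    have h1 : G < N := by
      refine lt_of_le_of_lt (Nat.le_ceil G) ?_
      exact_mod_cast (by omega : ⌈G⌉₊ < N)
    have h2 : G / (N : ℝ) ^ 2 < 1 := by
      rw [div_lt_one (by positivity)]; nlinarith
    nlinarith
  -- the gap of the second-order terms beats the two third-order errors
  have hcompare : ∀ D E : Finset (Fin N → ℂ), D ⊆ P → E ⊆ P →
      ((P \ D).card : ℝ) ≤ G / (N : ℝ) ^ 2 * P.card →
      ((P \ E).card : ℝ) ≤ G / (N : ℝ) ^ 2 * P.card → D ⊆ A →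
      c₁ / 2 / (N : ℝ) ^ 2 ≤ condAmpCRB σ τ β (U N) D - condAmpCRB σ τ β (ofdm N) E := by
    intro D E hDP hEP hDc hEc hDA
    have h1 := hexp N (by omega) (U N) hUu D hDP hDc fun s hs => hAinv' s (hDA hs)
    have h2 := hexp N (by omega) (ofdm N) hOu E hEP hEc fun s hs => hOinv s (hEP hs)
    have h3 := expect_crbForm_sub_ofdm (σ := σ) (τ := τ) (β := β) hmean hpower hpseudo hN0 hUu
    have h4 := mul_le_mul_of_nonneg_left (hgap N (by omega) (U N) hUs) hκ.le
    rw [← h3, ← mul_div_assoc, ← hc₁] at h4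
    set q := Real.sqrt N with hq
    have hq0 : 0 < q := Real.sqrt_pos.2 hNR
    have hqN : (N : ℝ) = q ^ 2 := (Real.sq_sqrt hNR.le).symm
    have hqR : 4 * R / c₁ ≤ q := by
      refine Real.le_sqrt_of_sq_le ((Nat.le_ceil _).trans ?_)
      exact_mod_cast (by omega : ⌈(4 * R / c₁) ^ 2⌉₊ ≤ N)
    have h5 : 2 * (R / q ^ 5) ≤ c₁ / 2 / (N : ℝ) ^ 2 := by
      rw [hqN, ← mul_div_assoc, div_div, div_le_div_iff₀ (by positivity) (by positivity)]
      rw [div_le_iff₀ hc₁0] at hqR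
      have : 0 < q ^ 4 := by positivity
      nlinarith
    have h6 : c₁ / (N : ℝ) ^ 2 = c₁ / 2 / (N : ℝ) ^ 2 + c₁ / 2 / (N : ℝ) ^ 2 := by ring
    rw [abs_le] at h1 h2
    linarith [h1.1, h2.2]
  exact ⟨hnonempty, fun s hs => (hAinv s hs).1, fun s hs => (hOinv s hs).1,
    hcompare A O hAP hOP (hAc.trans hmono) (hOc.trans hmono) subset_rfl,
    hcompare A A hAP hAP (hAc.trans hmono) (hAc.trans hmono) subset_rfl,
    hcompare (A ∩ O) (A ∩ O) hAOP hAOP hAOc hAOc Finset.inter_subset_left⟩
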